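/- Let $c\in\mathbb R$ with $|c|>1$. Functions on $\mathbb R$ are complex-valued unless said otherwise. For real $r\ge 0$ and $q>0$ let $H^r_q=\{f\in H^r(\mathbb R):\cosh^q(\cdot)f\in H^r(\mathbb R)\}$ with norm $\|f\|_{r,q}=\|\cosh^q(\cdot)f\|_{H^r}$, let $E^r_q$ be the subspace of even functions in $H^r_q$, and let $E^r_{q,0}=\{f\in E^r_q:\hat f(0)=0\}$, i.e. $\int_{\mathbb R}f=0$. Let $(Af)(x)=f(x+1)+f(x-1)$. An operator is called invertible from $X$ to $Y$ if it is a bounded linear bijection from $X$ onto $Y$ with bounded inverse. Assume the following. 1. There are $q_\varsigma>0$ and a real-valued $\varsigma\in E^2_{q_\varsigma}$ such that $c^2\varsigma''+(2-A)(\varsigma+\varsigma^2)=0$. 2. There is $q_{\mathcal H}\in(0,\min\{1,q_\varsigma\})$ such that the operator $\mathcal H_cf:=c^2f''+(2-A)\big((1+2\varsigma)f\big)$ is invertible from $E^2_{q_{\mathcal H}}$ to $E^0_{q_{\mathcal H},0}$. Then there exist $q^\star_{\mathcal H},q^{\star\star}_{\mathcal H}$ with $q_{\mathcal H}\le q^\star_{\mathcal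 H}<q^{\star\star}_{\mathcal H}<\min\{1,q_\varsigma\}$ such that for every $q\in[q^\star_{\mathcal H},q^{\star\star}_{\mathcal H}]$ and every real $r\ge 0$, the operator $\mathcal H_c$ is invertible from $E^{r+2}_q$ to $E^r_{q,0}$. -/

import Mathlib

open MeasureTheory Filter
open scoped ENNReal NNReal SchwartzMap LineDeriv FourierTransform

noncomputable section

namespace MonatomicFPUT

/-- Complex-valued square integrable functions on the line, modulo a.e. equality. -/
abbrev L2 : Type := Lp ℂ 2 (volume : Measure ℝ)

/-- The Sobolev space `H^r(ℝ)` of complex-valued functions, as a subspace of `L²` (`r ≥ 0`). -/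
def sobolev (r : ℝ) : Submodule ℂ L2 where
  carrier := {f | TemperedDistribution.MemSobolev r 2 (f : 𝓢'(ℝ, ℂ))}
  zero_mem' := by
    have h := TemperedDistribution.memSobolev_fun_zero ℝ ℂ r 2
    rw [← map_zero (Lp.toTemperedDistributionCLM ℂ (volume : Measure ℝ) 2)] at h
    exact h
  add_mem' := by
    intro f g hf hg
    have h := TemperedDistribution.MemSobolev.add hf hg
    rw [← Lp.toTemperedDistributionCLM_apply, ← Lp.toTemperedDistributionCLM_apply,
      ← map_add] at h
    exact h
  smul_mem' := by
    intro a f hf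
    have h := TemperedDistribution.MemSobolev.smul a hf
    rw [← Lp.toTemperedDistributionCLM_apply, ← map_smul] at h
    exact h

/-- The `H^r(ℝ)` norm `‖(1 + k²)^{r/2} f̂(k)‖_{L²}`. Mathlib's Fourier variable `ξ` is related to
the angular frequency by `k = 2πξ`, and `𝓕` is unitary on `L²`. -/
def sobolevENorm (r : ℝ) (f : L2) : ℝ≥0∞ :=
  eLpNorm (fun ξ : ℝ => (((1 + (2 * Real.pi * ξ) ^ 2) ^ (r / 2) : ℝ) : ℂ) * (𝓕 f : L2) ξ) 2 volume

/-- The pointwise product `cosh(x)^q f(x)`. -/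
def coshMul (q : ℝ) (f : ℝ → ℂ) (x : ℝ) : ℂ := ((Real.cosh x ^ q : ℝ) : ℂ) * f x

/-- `H_q^r = {f ∈ H^r : cosh^q f ∈ H^r}`. -/
def weightedSobolev (r q : ℝ) : Submodule ℂ L2 where
  carrier := {f | f ∈ sobolev r ∧ ∃ g ∈ sobolev r, g =ᵐ[volume] coshMul q f}
  zero_mem' := by
    refine ⟨zero_mem _, 0, zero_mem _, ?_⟩
    filter_upwards [Lp.coeFn_zero ℂ 2 (volume : Measure ℝ)] with x hx
    simp only [coshMul]
    rw [hx]
    simp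
  add_mem' := by
    rintro f₁ f₂ ⟨h₁, g₁, hg₁, e₁⟩ ⟨h₂, g₂, hg₂, e₂⟩
    refine ⟨add_mem h₁ h₂, g₁ + g₂, add_mem hg₁ hg₂, ?_⟩
    filter_upwards [e₁, e₂, Lp.coeFn_add f₁ f₂, Lp.coeFn_add g₁ g₂] with x a b c d
    simp only [coshMul, Pi.add_apply] at *
    rw [d, a, b, c, mul_add]
  smul_mem' := by
    rintro a f ⟨h, g, hg, e⟩
    refine ⟨Submodule.smul_mem _ a h, a • g, Submodule.smul_mem _ a hg, ?_⟩
    filter_upwards [e, Lp.coeFn_smul a f, Lp.coeFn_smul a g] with x b c d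
    simp only [coshMul, Pi.smul_apply, smul_eq_mul] at *
    rw [d, b, c]
    ring

/-- The norm `‖f‖_{r,q} = ‖cosh^q f‖_{H^r}`. At most one `g` in `L²` satisfies the condition, so
the infimum is its `H^r` norm (and `∞` if there is none). -/
def weightedENorm (r q : ℝ) (f : L2) : ℝ≥0∞ :=
  ⨅ (g : L2) (_ : g =ᵐ[volume] coshMul q f), sobolevENorm r g

/-- Even functions in `L²`. -/
def evenL2 : Submodule ℂ L2 where
  carrier := {f | ∀ᵐ x : ℝ, f (-x) = f x}
  zero_mem' := by
    have h := Lp.coeFn_zero ℂ 2 (volume : Measure ℝ)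
    filter_upwards [h, (Measure.measurePreserving_neg (volume : Measure ℝ)).quasiMeasurePreserving.ae h]
      with x a b
    rw [a, b]
    rfl
  add_mem' := by
    intro f g hf hg
    have h := Lp.coeFn_add f g
    filter_upwards [hf, hg, h,
      (Measure.measurePreserving_neg (volume : Measure ℝ)).quasiMeasurePreserving.ae h]
      with x a b c d
    rw [c, d, Pi.add_apply, Pi.add_apply, a, b]
  smul_mem' := by
    intro s f hf
    have h := Lp.coeFn_smul s f
    filter_upwards [hf, h,
      (Measure.measurePreserving_neg (volume : Measure ℝ)).quasiMeasurePreserving.ae h]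
      with x a c d
    rw [c, d, Pi.smul_apply, Pi.smul_apply, a]

/-- Mean-zero functions, that is, `f̂(0) = (2π)^{-1/2} ∫ f = 0`. -/
def meanZeroL2 : Submodule ℂ L2 where
  carrier := {f | Integrable f (volume : Measure ℝ) ∧ ∫ x : ℝ, f x = 0}
  zero_mem' := by
    have h := Lp.coeFn_zero ℂ 2 (volume : Measure ℝ)
    refine ⟨(integrable_congr h).2 (integrable_zero _ _ _), ?_⟩
    rw [integral_congr_ae h]
    simp
  add_mem' := by
    rintro f g ⟨hf, hf0⟩ ⟨hg, hg0⟩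
    have h := Lp.coeFn_add f g
    refine ⟨(integrable_congr h).2 (hf.add hg), ?_⟩
    rw [integral_congr_ae h, integral_add' hf hg, hf0, hg0, add_zero]
  smul_mem' := by
    rintro s f ⟨hf, hf0⟩
    have h := Lp.coeFn_smul s f
    refine ⟨(integrable_congr h).2 (hf.smul s), ?_⟩
    rw [integral_congr_ae h]
    simp only [Pi.smul_apply]
    rw [integral_smul, hf0, smul_zero]

/-- `E_q^r = H_q^r ∩ {even functions}`. -/
def E (r q : ℝ) : Submodule ℂ L2 := weightedSobolev r q ⊓ evenL2

/-- `E_{q,0}^r = {f ∈ E_q^r : f̂(0) = 0}`. For `q > 0` every element of `E_q^r` is integrable. -/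
def E₀ (r q : ℝ) : Submodule ℂ L2 := E r q ⊓ meanZeroL2

open Classical in
/-- The second (distributional) derivative of `f`, when it lies in `L²`, as it does for
`f ∈ H²`; the value `0` otherwise is never used. -/
def secondDeriv (f : L2) : L2 :=
  if h : ∃ g : L2, (g : 𝓢'(ℝ, ℂ)) = ∂_{(1 : ℝ)} (∂_{(1 : ℝ)} (f : 𝓢'(ℝ, ℂ))) then h.choose else 0

theorem secondDeriv_spec {r : ℝ} (hr : 2 ≤ r) {f : L2} (hf : f ∈ sobolev r) :
    (secondDeriv f : 𝓢'(ℝ, ℂ)) = ∂_{(1 : ℝ)} (∂_{(1 : ℝ)} (f : 𝓢'(ℝ, ℂ))) := by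
  have h : ∃ g : L2, (g : 𝓢'(ℝ, ℂ)) = ∂_{(1 : ℝ)} (∂_{(1 : ℝ)} (f : 𝓢'(ℝ, ℂ))) := by
    have h₁ : TemperedDistribution.MemSobolev r 2 (f : 𝓢'(ℝ, ℂ)) := hf
    have h₂ := (h₁.lineDerivOp (m := (1 : ℝ))).lineDerivOp (m := (1 : ℝ))
    obtain ⟨g, hg⟩ := TemperedDistribution.memSobolev_zero_iff.1
      (h₂.mono (s' := 0) (by linarith))
    exact ⟨g, hg.symm⟩
  rw [secondDeriv, dif_pos h]
  exact h.choose_spec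

/-- `(2 - A) g = 2 g - S^1 g - S^{-1} g`, where `(S^d g)(x) = g (x + d)`. -/
def twoSubA (g : ℝ → ℂ) (x : ℝ) : ℂ := 2 * g x - (g (x + 1) + g (x - 1))

/-- `ς` solves the monatomic travelling wave equation `c² ς'' + (2 - A)(ς + ς²) = 0`. -/
def IsTravelingWave (c : ℝ) (ς : L2) : Prop :=
  ∀ᵐ x : ℝ, (c : ℂ) ^ 2 * secondDeriv ς x + twoSubA (fun y => ς y + ς y ^ 2) x = 0

/-- The linearization `H_c f = c² f'' + (2 - A)((1 + 2 ς) f)`. -/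
def linearization (c : ℝ) (ς f : L2) (x : ℝ) : ℂ :=
  (c : ℂ) ^ 2 * secondDeriv f x + twoSubA (fun y => (1 + 2 * ς y) * f y) x

/-- `H_c` is invertible from `E_q^s` to `E_{q,0}^r`: it is a linear bijection between these spaces,
and both it and its inverse are bounded. -/
def IsInvertible (c : ℝ) (ς : L2) (s r q : ℝ) : Prop :=
  ∃ T : E s q ≃ₗ[ℂ] E₀ r q,
    (∀ f : E s q, (T f : L2) =ᵐ[volume] linearization c ς f) ∧
    (∃ C : ℝ≥0, ∀ f : E s q, weightedENorm r q (T f) ≤ C * weightedENorm s q f) ∧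
    (∃ C : ℝ≥0, ∀ g : E₀ r q, weightedENorm s q (T.symm g) ≤ C * weightedENorm r q g)

end MonatomicFPUT

end

/-!
Conjugating `c² ∂² + (2 - A)(1 + 2ς)` by `cosh^q` turns the weighted spaces into the unweighted
Sobolev scale and the operator into `c² ∂²` plus terms of order at most one, whose coefficients are
bounded and depend continuously on `q`. The principal part does not depend on `q`, so the conjugated
operators `H² → L²` are continuous in `q` in operator norm. The requirement `∫ f = 0` becomes
orthogonality to the even function `cosh^{-q}`; hence, although the range moves with `q`, projecting
orthogonally onto the range at `q_H` reduces the invertibility for nearby `q` to a Neumann series.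
The travelling wave equation expresses `ς''` through `ς` without derivatives, so `ς` is smooth with
bounded derivatives, and elliptic regularity carries the invertibility from `r = 0` to all `r ≥ 0`.
-/

noncomputable section

namespace MonatomicFPUT

/-! ### The Sobolev scale and weak derivatives -/

theorem locallyIntegrable_coe (f : L2) : LocallyIntegrable f (volume : Measure ℝ) :=
  (Lp.memLp f).locallyIntegrable one_le_two

theorem ae_eq_of_integral_schwartz_mul_eq {u v : ℝ → ℂ} (hu : LocallyIntegrable u volume)
    (hv : LocallyIntegrable v volume)
    (h : ∀ φ : 𝓢(ℝ, ℂ), ∫ x, φ x * u x = ∫ x, φ x * v x) : u =ᵐ[volume] v := by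
  refine ae_eq_of_integral_contDiff_smul_eq hu hv fun g g_smooth g_cpt => ?_
  have cpt : HasCompactSupport (Complex.ofRealCLM ∘ g) := g_cpt.comp_left rfl
  have smooth : ContDiff ℝ ((⊤ : ℕ∞) : WithTop ℕ∞) (Complex.ofRealCLM ∘ g) := by fun_prop
  exact h (cpt.toSchwartzMap smooth)

theorem coe_eq_smulLeftCLM_iff {h : ℝ → ℂ} (hh : h.HasTemperateGrowth) (u v : L2) :
    (v : 𝓢'(ℝ, ℂ)) = TemperedDistribution.smulLeftCLM ℂ h (u : 𝓢'(ℝ, ℂ)) ↔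
      v =ᵐ[volume] fun x => h x * u x := by
  constructor
  · intro H
    have locInt : LocallyIntegrable (fun x => h x * u x) volume :=
      locallyIntegrableOn_univ.1 (((locallyIntegrable_coe u).locallyIntegrableOn _).continuousOn_mul
        hh.1.continuous.continuousOn isOpen_univ.isLocallyClosed)
    refine ae_eq_of_integral_schwartz_mul_eq (locallyIntegrable_coe v) locInt fun φ => ?_
    have := DFunLike.congr_fun H φ
    simp only [Lp.toTemperedDistribution_apply, TemperedDistribution.smulLeftCLM_apply_apply,
      SchwartzMap.smulLeftCLM_apply_apply hh, smul_eq_mul] at this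
    rw [this]
    exact integral_congr_ae (Eventually.of_forall fun x => by ring)
  · intro H
    ext φ
    simp only [Lp.toTemperedDistribution_apply, TemperedDistribution.smulLeftCLM_apply_apply]
    refine integral_congr_ae ?_
    filter_upwards [H] with x hx
    rw [hx, SchwartzMap.smulLeftCLM_apply_apply hh]
    simp only [smul_eq_mul]
    ring

theorem toTemperedDistribution_injective :
    Function.Injective fun f : L2 => (f : 𝓢'(ℝ, ℂ)) :=
  LinearMap.ker_eq_bot.1 (Lp.ker_toTemperedDistributionCLM_eq_bot (F := ℂ) (p := 2))

/-- The weight `(1 + k²)^{r/2}`, `k = 2πξ`, of the `H^r` norm on the Fourier side. -/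
def sobolevWeight (r ξ : ℝ) : ℝ := (1 + (2 * Real.pi * ξ) ^ 2) ^ (r / 2)

theorem sobolevWeight_pos (r ξ : ℝ) : 0 < sobolevWeight r ξ := by
  unfold sobolevWeight; positivity

theorem continuous_sobolevWeight (r : ℝ) : Continuous (sobolevWeight r) :=
  Continuous.rpow_const (by fun_prop) fun _ => Or.inl (by positivity)

theorem sobolevWeight_mono {r s : ℝ} (h : r ≤ s) (ξ : ℝ) :
    sobolevWeight r ξ ≤ sobolevWeight s ξ :=
  Real.rpow_le_rpow_of_exponent_le (le_add_of_nonneg_right (sq_nonneg _)) (by linarith)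

theorem sobolevWeight_add (r s ξ : ℝ) :
    sobolevWeight (r + s) ξ = sobolevWeight r ξ * sobolevWeight s ξ := by
  unfold sobolevWeight
  rw [← Real.rpow_add (by positivity), add_div]

theorem sobolevWeight_one (ξ : ℝ) : sobolevWeight 1 ξ = √(1 + (2 * Real.pi * ξ) ^ 2) := by
  rw [sobolevWeight, Real.sqrt_eq_rpow]

theorem norm_sobolevWeight_mul (r ξ : ℝ) (z : ℂ) :
    ‖(sobolevWeight r ξ : ℂ) * z‖ = sobolevWeight r ξ * ‖z‖ := by
  rw [norm_mul, Complex.norm_real, Real.norm_of_nonneg (sobolevWeight_pos r ξ).le]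

/-- The Fourier symbol `2πiξ` of the derivative. -/
def derivSymbol (ξ : ℝ) : ℂ := 2 * Real.pi * Complex.I * ξ

theorem norm_derivSymbol (ξ : ℝ) : ‖derivSymbol ξ‖ = |2 * Real.pi * ξ| := by
  simp [derivSymbol, abs_mul]

theorem norm_derivSymbol_le (ξ : ℝ) : ‖derivSymbol ξ‖ ≤ sobolevWeight 1 ξ := by
  rw [norm_derivSymbol, sobolevWeight_one]
  exact Real.abs_le_sqrt (by linarith)

theorem sobolevWeight_one_le (ξ : ℝ) : sobolevWeight 1 ξ ≤ 1 + ‖derivSymbol ξ‖ := by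
  rw [norm_derivSymbol, sobolevWeight_one, Real.sqrt_le_left (by positivity),
    ← sq_abs (2 * Real.pi * ξ)]
  nlinarith [abs_nonneg (2 * Real.pi * ξ)]

theorem sobolevENorm_eq (r : ℝ) (f : L2) :
    sobolevENorm r f = eLpNorm (fun ξ : ℝ => (sobolevWeight r ξ : ℂ) * (𝓕 f : L2) ξ) 2 volume :=
  rfl

theorem aestronglyMeasurable_sobolevWeight_mul (r : ℝ) (f : L2) :
    AEStronglyMeasurable (fun ξ : ℝ => (sobolevWeight r ξ : ℂ) * (𝓕 f : L2) ξ) volume :=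
  (Complex.continuous_ofReal.comp (continuous_sobolevWeight r)).aestronglyMeasurable.mul
    (Lp.aestronglyMeasurable _)

theorem rpow_one_add_sq_le_sobolevWeight {r : ℝ} (hr : 0 ≤ r) (ξ : ℝ) :
    (1 + ‖ξ‖ ^ 2) ^ (r / 2) ≤ sobolevWeight r ξ := by
  have hpi : (1 : ℝ) ≤ (2 * Real.pi) ^ 2 := one_le_pow₀ (by linarith [Real.pi_gt_three])
  refine Real.rpow_le_rpow (by positivity) ?_ (by linarith)
  rw [Real.norm_eq_abs, sq_abs, mul_pow]
  nlinarith [sq_nonneg ξ]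

theorem sobolevWeight_le_mul_rpow {r : ℝ} (hr : 0 ≤ r) (ξ : ℝ) :
    sobolevWeight r ξ ≤ (2 * Real.pi) ^ r * (1 + ‖ξ‖ ^ 2) ^ (r / 2) := by
  have hpi : (1 : ℝ) ≤ (2 * Real.pi) ^ 2 := one_le_pow₀ (by linarith [Real.pi_gt_three])
  have : (2 * Real.pi) ^ r = ((2 * Real.pi) ^ 2) ^ (r / 2) := by
    rw [← Real.rpow_natCast_mul (by positivity)]
    congr 1; push_cast; ring
  rw [this, ← Real.mul_rpow (by positivity) (by positivity)]
  refine Real.rpow_le_rpow (by positivity) ?_ (by linarith)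
  rw [Real.norm_eq_abs, sq_abs]
  nlinarith

theorem mem_sobolev_iff_memLp {r : ℝ} (f : L2) :
    f ∈ sobolev r ↔
      MemLp (fun ξ : ℝ => (((1 + ‖ξ‖ ^ 2) ^ (r / 2) : ℝ) : ℂ) * (𝓕 f : L2) ξ) 2 volume := by
  have ht : (fun ξ : ℝ => (((1 + ‖ξ‖ ^ 2) ^ (r / 2) : ℝ) : ℂ)).HasTemperateGrowth := by fun_prop
  change TemperedDistribution.MemSobolev r 2 (f : 𝓢'(ℝ, ℂ)) ↔ _
  rw [TemperedDistribution.memSobolev_iff_exists_smulLeftCLM_fourier,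
    Lp.fourier_toTemperedDistribution_eq]
  constructor
  · rintro ⟨v, hv⟩
    exact (memLp_congr_ae ((coe_eq_smulLeftCLM_iff ht _ _).1 hv.symm)).1 (Lp.memLp v)
  · intro h
    exact ⟨h.toLp, ((coe_eq_smulLeftCLM_iff ht _ _).2 h.coeFn_toLp).symm⟩

theorem mem_sobolev_iff {r : ℝ} (hr : 0 ≤ r) (f : L2) :
    f ∈ sobolev r ↔ sobolevENorm r f < ∞ := by
  have norm_eq (ξ : ℝ) : ‖(((1 + ‖ξ‖ ^ 2) ^ (r / 2) : ℝ) : ℂ) * (𝓕 f : L2) ξ‖ =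
      (1 + ‖ξ‖ ^ 2) ^ (r / 2) * ‖(𝓕 f : L2) ξ‖ := by
    rw [norm_mul, Complex.norm_real, Real.norm_of_nonneg (by positivity)]
  rw [mem_sobolev_iff_memLp, sobolevENorm_eq]
  constructor
  · intro h
    refine (MemLp.of_le_mul (c := (2 * Real.pi) ^ r) h
      (aestronglyMeasurable_sobolevWeight_mul r f) (Eventually.of_forall fun ξ => ?_)).2
    rw [norm_sobolevWeight_mul, norm_eq, ← mul_assoc]
    gcongr
    exact sobolevWeight_le_mul_rpow hr ξ
  · intro h
    have hcont : Continuous fun ξ : ℝ => (((1 + ‖ξ‖ ^ 2) ^ (r / 2) : ℝ) : ℂ) :=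
      Complex.continuous_ofReal.comp
        (Continuous.rpow_const (by fun_prop) fun _ => Or.inl (by positivity))
    refine MemLp.of_le ⟨aestronglyMeasurable_sobolevWeight_mul r f, h⟩
      (hcont.aestronglyMeasurable.mul (Lp.aestronglyMeasurable _))
      (Eventually.of_forall fun ξ => ?_)
    rw [norm_sobolevWeight_mul, norm_eq]
    gcongr
    exact rpow_one_add_sq_le_sobolevWeight hr ξ

theorem sobolevENorm_zero_left (f : L2) : sobolevENorm 0 f = ‖f‖ₑ := by
  have : (fun ξ : ℝ => (sobolevWeight 0 ξ : ℂ) * (𝓕 f : L2) ξ) = (𝓕 f : L2) := by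
    ext ξ
    simp [sobolevWeight]
  rw [sobolevENorm_eq, this, ← Lp.enorm_def, ← ofReal_norm, Lp.norm_fourier_eq, ofReal_norm]

theorem mem_sobolev_zero (f : L2) : f ∈ sobolev 0 := by
  rw [mem_sobolev_iff le_rfl, sobolevENorm_zero_left]
  exact enorm_lt_top

theorem sobolevENorm_mono {r s : ℝ} (h : r ≤ s) (f : L2) :
    sobolevENorm r f ≤ sobolevENorm s f := by
  rw [sobolevENorm_eq, sobolevENorm_eq]
  refine eLpNorm_mono fun ξ => ?_
  rw [norm_sobolevWeight_mul, norm_sobolevWeight_mul]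
  gcongr
  exact sobolevWeight_mono h ξ

theorem sobolev_anti {r s : ℝ} (h : r ≤ s) : sobolev s ≤ sobolev r :=
  fun _ hf => TemperedDistribution.MemSobolev.mono h hf

theorem enorm_le_sobolevENorm {r : ℝ} (hr : 0 ≤ r) (f : L2) : ‖f‖ₑ ≤ sobolevENorm r f := by
  rw [← sobolevENorm_zero_left]
  exact sobolevENorm_mono hr f

theorem fourier_add_ae (f g : L2) :
    (𝓕 (f + g) : L2) =ᵐ[volume] fun ξ => (𝓕 f : L2) ξ + (𝓕 g : L2) ξ := by
  rw [FourierTransform.fourier_add]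
  exact Lp.coeFn_add _ _

theorem fourier_smul_ae (a : ℂ) (f : L2) :
    (𝓕 (a • f) : L2) =ᵐ[volume] fun ξ => a * (𝓕 f : L2) ξ := by
  rw [FourierTransform.fourier_smul]
  exact Lp.coeFn_smul _ _

theorem sobolevENorm_add_le (r : ℝ) (f g : L2) :
    sobolevENorm r (f + g) ≤ sobolevENorm r f + sobolevENorm r g := by
  simp only [sobolevENorm_eq]
  refine le_trans (le_of_eq (eLpNorm_congr_ae ?_)) (eLpNorm_add_le
    (aestronglyMeasurable_sobolevWeight_mul r f)
    (aestronglyMeasurable_sobolevWeight_mul r g) one_le_two)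
  filter_upwards [fourier_add_ae f g] with ξ h
  rw [h, Pi.add_apply, mul_add]

theorem sobolevENorm_smul (r : ℝ) (a : ℂ) (f : L2) :
    sobolevENorm r (a • f) = ‖a‖ₑ * sobolevENorm r f := by
  simp only [sobolevENorm_eq]
  rw [← eLpNorm_const_smul]
  refine eLpNorm_congr_ae ?_
  filter_upwards [fourier_smul_ae a f] with ξ h
  rw [h, Pi.smul_apply, smul_eq_mul]
  ring

theorem sobolevENorm_sub_le (r : ℝ) (f g : L2) :
    sobolevENorm r (f - g) ≤ sobolevENorm r f + sobolevENorm r g := by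
  have h := sobolevENorm_add_le r f ((-1 : ℂ) • g)
  rwa [sobolevENorm_smul, enorm_neg, enorm_one, one_mul, neg_one_smul, ← sub_eq_add_neg] at h

/-- `g` is the distributional derivative of `f`, both being square integrable. -/
def HasWeakDeriv (f g : L2) : Prop := (g : 𝓢'(ℝ, ℂ)) = ∂_{(1 : ℝ)} (f : 𝓢'(ℝ, ℂ))

theorem HasWeakDeriv.unique {f g h : L2} (hg : HasWeakDeriv f g) (hh : HasWeakDeriv f h) :
    g = h :=
  toTemperedDistribution_injective (hg.trans hh.symm)

theorem hasWeakDeriv_iff_integral {f g : L2} :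
    HasWeakDeriv f g ↔ ∀ φ : 𝓢(ℝ, ℂ), ∫ x, φ x * g x = -∫ x, deriv φ x * f x := by
  have apply_eq (φ : 𝓢(ℝ, ℂ)) :
      (∂_{(1 : ℝ)} (f : 𝓢'(ℝ, ℂ))) φ = -∫ x, deriv φ x * f x := by
    rw [TemperedDistribution.lineDerivOp_apply_apply, map_neg, Lp.toTemperedDistribution_apply]
    rfl
  unfold HasWeakDeriv
  constructor
  · intro h φ
    rw [← apply_eq, ← h, Lp.toTemperedDistribution_apply]
    rfl
  · intro h
    ext φ
    rw [apply_eq, ← h, Lp.toTemperedDistribution_apply]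
    rfl

theorem hasWeakDeriv_iff_fourier {f g : L2} :
    HasWeakDeriv f g ↔ (𝓕 g : L2) =ᵐ[volume] fun ξ => derivSymbol ξ * (𝓕 f : L2) ξ := by
  have ht : derivSymbol.HasTemperateGrowth := by unfold derivSymbol; fun_prop
  have fourier_deriv : TemperedDistribution.smulLeftCLM ℂ derivSymbol (𝓕 (f : 𝓢'(ℝ, ℂ))) =
      𝓕 (∂_{(1 : ℝ)} (f : 𝓢'(ℝ, ℂ))) := by
    have hinner : (fun ξ : ℝ => ((inner ℝ ξ (1 : ℝ) : ℝ) : ℂ)).HasTemperateGrowth := by fun_prop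
    rw [TemperedDistribution.fourier_lineDerivOp_eq, ← smul_apply,
      ← TemperedDistribution.smulLeftCLM_smul hinner]
    congr 2
    ext ξ
    simp [derivSymbol]
  rw [← coe_eq_smulLeftCLM_iff ht, ← Lp.fourier_toTemperedDistribution_eq,
    ← Lp.fourier_toTemperedDistribution_eq, fourier_deriv]
  exact (FourierTransform.fourierEquiv ℂ (𝓢'(ℝ, ℂ))).injective.eq_iff.symm

theorem HasWeakDeriv.sobolevENorm_le {f g : L2} (h : HasWeakDeriv f g) (r : ℝ) :
    sobolevENorm r g ≤ sobolevENorm (r + 1) f := by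
  simp only [sobolevENorm_eq]
  refine eLpNorm_mono_ae ?_
  filter_upwards [hasWeakDeriv_iff_fourier.1 h] with ξ hξ
  rw [hξ, norm_sobolevWeight_mul, norm_sobolevWeight_mul, sobolevWeight_add, norm_mul, mul_assoc]
  gcongr
  · exact (sobolevWeight_pos r ξ).le
  · exact norm_derivSymbol_le ξ

theorem HasWeakDeriv.sobolevENorm_succ_le {f g : L2} (h : HasWeakDeriv f g) (r : ℝ) :
    sobolevENorm (r + 1) f ≤ sobolevENorm r f + sobolevENorm r g := by
  simp only [sobolevENorm_eq]
  rw [← eLpNorm_norm fun ξ => (sobolevWeight r ξ : ℂ) * (𝓕 f : L2) ξ,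
    ← eLpNorm_norm fun ξ => (sobolevWeight r ξ : ℂ) * (𝓕 g : L2) ξ]
  refine le_trans ?_ (eLpNorm_add_le (aestronglyMeasurable_sobolevWeight_mul r f).norm
    (aestronglyMeasurable_sobolevWeight_mul r g).norm one_le_two)
  refine eLpNorm_mono_ae ?_
  filter_upwards [hasWeakDeriv_iff_fourier.1 h] with ξ hξ
  rw [Pi.add_apply, Real.norm_of_nonneg (by positivity), hξ, norm_sobolevWeight_mul,
    norm_sobolevWeight_mul, norm_sobolevWeight_mul, norm_mul, sobolevWeight_add]
  calc sobolevWeight r ξ * sobolevWeight 1 ξ * ‖(𝓕 f : L2) ξ‖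
      ≤ sobolevWeight r ξ * (1 + ‖derivSymbol ξ‖) * ‖(𝓕 f : L2) ξ‖ := by
        gcongr
        · exact (sobolevWeight_pos r ξ).le
        · exact sobolevWeight_one_le ξ
    _ = _ := by ring

theorem HasWeakDeriv.mem_sobolev {r : ℝ} (hr : 0 ≤ r) {f g : L2} (h : HasWeakDeriv f g)
    (hf : f ∈ sobolev (r + 1)) : g ∈ sobolev r := by
  rw [mem_sobolev_iff hr]
  rw [mem_sobolev_iff (by linarith)] at hf
  exact (h.sobolevENorm_le r).trans_lt hf

theorem HasWeakDeriv.mem_sobolev_succ {r : ℝ} (hr : 0 ≤ r) {f g : L2} (h : HasWeakDeriv f g)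
    (hf : f ∈ sobolev r) (hg : g ∈ sobolev r) : f ∈ sobolev (r + 1) := by
  rw [mem_sobolev_iff (by linarith)]
  rw [mem_sobolev_iff hr] at hf hg
  exact (h.sobolevENorm_succ_le r).trans_lt (ENNReal.add_lt_top.2 ⟨hf, hg⟩)

theorem HasWeakDeriv.mem_sobolev_one {f g : L2} (h : HasWeakDeriv f g) : f ∈ sobolev 1 := by
  simpa only [zero_add] using h.mem_sobolev_succ le_rfl (mem_sobolev_zero f) (mem_sobolev_zero g)

theorem HasWeakDeriv.add {f g f' g' : L2} (hf : HasWeakDeriv f f') (hg : HasWeakDeriv g g') :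
    HasWeakDeriv (f + g) (f' + g') := by
  rw [hasWeakDeriv_iff_fourier] at *
  filter_upwards [hf, hg, fourier_add_ae f g, fourier_add_ae f' g'] with ξ hf hg hfg hfg'
  rw [hfg', hfg, hf, hg, mul_add]

theorem HasWeakDeriv.smul {f f' : L2} (a : ℂ) (hf : HasWeakDeriv f f') :
    HasWeakDeriv (a • f) (a • f') := by
  rw [hasWeakDeriv_iff_fourier] at *
  filter_upwards [hf, fourier_smul_ae a f, fourier_smul_ae a f'] with ξ hf haf haf'
  rw [haf', haf, hf]
  ring

open Classical in
/-- The weak derivative of `f` when it lies in `L²`, as it does for `f ∈ H¹`; the value `0`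
otherwise is never used. -/
def weakDeriv (f : L2) : L2 := if h : ∃ g : L2, HasWeakDeriv f g then h.choose else 0

theorem HasWeakDeriv.weakDeriv_eq {f g : L2} (h : HasWeakDeriv f g) : weakDeriv f = g := by
  have h' : ∃ g : L2, HasWeakDeriv f g := ⟨g, h⟩
  rw [weakDeriv, dif_pos h']
  exact h'.choose_spec.unique h

theorem hasWeakDeriv_weakDeriv {f : L2} (hf : f ∈ sobolev 1) : HasWeakDeriv f (weakDeriv f) := by
  have hf' : TemperedDistribution.MemSobolev 1 2 (f : 𝓢'(ℝ, ℂ)) := hf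
  obtain ⟨g, hg⟩ := TemperedDistribution.memSobolev_zero_iff.1
    ((hf'.lineDerivOp (m := (1 : ℝ))).mono (s' := 0) (by linarith))
  have hg : HasWeakDeriv f g := hg.symm
  rwa [hg.weakDeriv_eq]

theorem weakDeriv_mem_sobolev {r : ℝ} (hr : 0 ≤ r) {f : L2} (hf : f ∈ sobolev (r + 1)) :
    weakDeriv f ∈ sobolev r :=
  (hasWeakDeriv_weakDeriv (sobolev_anti (by linarith) hf)).mem_sobolev hr hf

theorem weakDeriv_mem_sobolev_one {f : L2} (hf : f ∈ sobolev 2) : weakDeriv f ∈ sobolev 1 :=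
  weakDeriv_mem_sobolev zero_le_one (by norm_num; exact hf)

theorem sobolevENorm_weakDeriv_le (r : ℝ) {f : L2} (hf : f ∈ sobolev 1) :
    sobolevENorm r (weakDeriv f) ≤ sobolevENorm (r + 1) f :=
  (hasWeakDeriv_weakDeriv hf).sobolevENorm_le r

theorem secondDeriv_eq {f : L2} (hf : f ∈ sobolev 2) :
    secondDeriv f = weakDeriv (weakDeriv f) := by
  have h₁ : HasWeakDeriv f (weakDeriv f) :=
    hasWeakDeriv_weakDeriv (sobolev_anti one_le_two hf)
  have h₂ : HasWeakDeriv (weakDeriv f) (weakDeriv (weakDeriv f)) :=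
    hasWeakDeriv_weakDeriv (weakDeriv_mem_sobolev_one hf)
  refine toTemperedDistribution_injective ?_
  dsimp only
  rw [secondDeriv_spec le_rfl hf, ← h₁, ← h₂]

/-! ### Bounded smooth functions -/

/-- `m` is `C^n` and its derivatives of order at most `n`, including `m` itself, are bounded. -/
structure BddContDiff (n : ℕ∞) (m : ℝ → ℂ) : Prop where
  contDiff : ContDiff ℝ n m
  bdd_iteratedDeriv : ∀ k : ℕ, k ≤ n → ∃ C : ℝ, ∀ x, ‖iteratedDeriv k m x‖ ≤ C

/-- `m` is smooth and all its derivatives are bounded. -/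
abbrev BddSmooth (m : ℝ → ℂ) : Prop := BddContDiff ⊤ m

namespace BddContDiff

variable {n : ℕ∞} {m k : ℝ → ℂ}

theorem of_le {n' : ℕ∞} (hm : BddContDiff n m) (h : n' ≤ n) : BddContDiff n' m :=
  ⟨hm.contDiff.of_le (by exact_mod_cast h), fun j hj => hm.bdd_iteratedDeriv j (hj.trans h)⟩

theorem bdd (hm : BddContDiff n m) : ∃ C : ℝ, ∀ x, ‖m x‖ ≤ C := by
  simpa only [iteratedDeriv_zero] using hm.bdd_iteratedDeriv 0 (by simp)

theorem continuous (hm : BddContDiff n m) : Continuous m := hm.contDiff.continuous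

theorem zero_iff : BddContDiff 0 m ↔ Continuous m ∧ ∃ C : ℝ, ∀ x, ‖m x‖ ≤ C := by
  refine ⟨fun h => ⟨h.continuous, h.bdd⟩, fun h => ⟨contDiff_zero.2 h.1, fun j hj => ?_⟩⟩
  obtain rfl : j = 0 := by simpa using hj
  simpa only [iteratedDeriv_zero] using h.2

theorem top_of_forall_nat (h : ∀ j : ℕ, BddContDiff j m) : BddSmooth m :=
  ⟨contDiff_infty.2 fun j => (h j).contDiff, fun j _ => (h j).bdd_iteratedDeriv j le_rfl⟩

theorem succ_of_hasDerivAt {m' : ℝ → ℂ} (hb : ∃ C : ℝ, ∀ x, ‖m x‖ ≤ C)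
    (hd : ∀ x, HasDerivAt m (m' x) x) (hm' : BddContDiff n m') : BddContDiff (n + 1) m := by
  obtain rfl : deriv m = m' := funext fun x => (hd x).deriv
  constructor
  · push_cast
    exact contDiff_succ_iff_deriv.2
      ⟨fun x => (hd x).differentiableAt, by simp, hm'.contDiff⟩
  · rintro (_ | j) hj
    · simpa only [iteratedDeriv_zero] using hb
    · rw [iteratedDeriv_succ']
      exact hm'.bdd_iteratedDeriv j (by simpa using hj)

theorem deriv (hm : BddContDiff (n + 1) m) : BddContDiff n (deriv m) := by
  refine ⟨?_, fun j hj => ?_⟩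
  · have h := hm.contDiff
    push_cast at h
    exact (contDiff_succ_iff_deriv.1 h).2.2
  · rw [← iteratedDeriv_succ']
    exact hm.bdd_iteratedDeriv (j + 1) (by push_cast; gcongr)

theorem hasDerivAt (hm : BddSmooth m) (x : ℝ) : HasDerivAt m (_root_.deriv m x) x :=
  (hm.contDiff.differentiable (by simp) x).hasDerivAt

theorem of_hasDerivAt {m' : ℝ → ℂ} (hm : BddSmooth m) (hd : ∀ x, HasDerivAt m (m' x) x) :
    BddSmooth m' := by
  obtain rfl : _root_.deriv m = m' := funext fun x => (hd x).deriv
  exact BddContDiff.deriv hm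

theorem const (a : ℂ) : BddContDiff n fun _ => a := by
  refine ⟨contDiff_const, fun j _ => ⟨‖a‖, fun x => ?_⟩⟩
  rw [iteratedDeriv_const]
  split_ifs <;> simp

theorem add (hm : BddContDiff n m) (hk : BddContDiff n k) :
    BddContDiff n fun x => m x + k x := by
  refine ⟨hm.contDiff.add hk.contDiff, fun j hj => ?_⟩
  obtain ⟨C, hC⟩ := hm.bdd_iteratedDeriv j hj
  obtain ⟨C', hC'⟩ := hk.bdd_iteratedDeriv j hj
  have hj' : (j : WithTop ℕ∞) ≤ n := by exact_mod_cast hj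
  refine ⟨C + C', fun x => ?_⟩
  rw [iteratedDeriv_fun_add (hm.contDiff.of_le hj').contDiffAt (hk.contDiff.of_le hj').contDiffAt]
  exact norm_add_le_of_le (hC x) (hC' x)

theorem mul (hm : BddContDiff n m) (hk : BddContDiff n k) :
    BddContDiff n fun x => m x * k x := by
  refine ⟨hm.contDiff.mul hk.contDiff, fun j hj => ?_⟩
  choose! C hC using hm.bdd_iteratedDeriv
  choose! C' hC' using hk.bdd_iteratedDeriv
  refine ⟨∑ i ∈ Finset.range (j + 1), j.choose i * C i * C' (j - i), fun x => ?_⟩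
  rw [← norm_iteratedFDeriv_eq_norm_iteratedDeriv]
  refine (norm_iteratedFDeriv_mul_le hm.contDiff hk.contDiff x (by exact_mod_cast hj)).trans
    (Finset.sum_le_sum fun i hi => ?_)
  rw [norm_iteratedFDeriv_eq_norm_iteratedDeriv, norm_iteratedFDeriv_eq_norm_iteratedDeriv]
  have hi : i ≤ j := Finset.mem_range_succ_iff.1 hi
  have hCi := hC i ((Nat.cast_le.2 hi).trans hj) x
  have := (norm_nonneg _).trans hCi
  gcongr
  exact hC' _ ((Nat.cast_le.2 (j.sub_le i)).trans hj) x

theorem const_mul (a : ℂ) (hm : BddContDiff n m) : BddContDiff n fun x => a * m x :=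
  (const a).mul hm

theorem sub (hm : BddContDiff n m) (hk : BddContDiff n k) :
    BddContDiff n fun x => m x - k x := by
  simpa only [neg_one_mul, ← sub_eq_add_neg] using hm.add (hk.const_mul (-1))

theorem comp_add_const (hm : BddContDiff n m) (a : ℝ) : BddContDiff n fun x => m (x + a) := by
  refine ⟨hm.contDiff.comp (contDiff_id.add contDiff_const), fun j hj => ?_⟩
  obtain ⟨C, hC⟩ := hm.bdd_iteratedDeriv j hj
  refine ⟨C, fun x => ?_⟩
  rw [iteratedDeriv_comp_add_const]
  exact hC _

theorem top_of_hasDerivAt_mul {a : ℝ → ℂ} (ha : BddSmooth a) (hb : ∃ C : ℝ, ∀ x, ‖m x‖ ≤ C)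
    (hd : ∀ x, HasDerivAt m (a x * m x) x) : BddSmooth m := by
  refine top_of_forall_nat fun j => ?_
  induction j with
  | zero =>
    exact zero_iff.2 ⟨continuous_iff_continuousAt.2 fun x => (hd x).continuousAt, hb⟩
  | succ j ih => exact succ_of_hasDerivAt hb hd ((ha.of_le le_top).mul ih)

theorem hasTemperateGrowth (hm : BddSmooth m) : m.HasTemperateGrowth := by
  refine ⟨hm.contDiff, fun j => ?_⟩
  obtain ⟨C, hC⟩ := hm.bdd_iteratedDeriv j le_top
  refine ⟨0, C, fun x => ?_⟩
  rw [norm_iteratedFDeriv_eq_norm_iteratedDeriv, pow_zero, mul_one]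
  exact hC x

theorem memLp_top (hm : BddContDiff n m) : MemLp m ∞ (volume : Measure ℝ) := by
  obtain ⟨C, hC⟩ := hm.bdd
  exact memLp_top_of_bound hm.continuous.aestronglyMeasurable C (Eventually.of_forall hC)

end BddContDiff

/-! ### Multiplication, translation and reflection -/

open Classical in
/-- Multiplication by the function `m` on `L²`, for essentially bounded `m`; the value `0`
otherwise is never used, but makes `mulL m` unconditionally linear. -/
def mulL (m : ℝ → ℂ) : L2 →L[ℂ] L2 :=
  if hm : MemLp m ∞ (volume : Measure ℝ) then
    (ContinuousLinearMap.mul ℂ ℂ).holderL volume ∞ 2 2 hm.toLp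
  else 0

theorem mulL_ae {m : ℝ → ℂ} (hm : MemLp m ∞ (volume : Measure ℝ)) (f : L2) :
    mulL m f =ᵐ[volume] fun x => m x * f x := by
  rw [mulL, dif_pos hm]
  filter_upwards [(ContinuousLinearMap.mul ℂ ℂ).coeFn_holder (r := 2) hm.toLp f, hm.coeFn_toLp]
    with x hx hmx
  rw [← hmx]
  exact hx

theorem mulL_eq_of_ae {m : ℝ → ℂ} (hm : MemLp m ∞ (volume : Measure ℝ)) {f g : L2}
    (h : g =ᵐ[volume] fun x => m x * f x) : mulL m f = g :=
  Lp.ext ((mulL_ae hm f).trans h.symm)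

theorem norm_mulL_le {m : ℝ → ℂ} (hm : MemLp m ∞ (volume : Measure ℝ)) {C : ℝ}
    (hC : ∀ x, ‖m x‖ ≤ C) (f : L2) : ‖mulL m f‖ ≤ C * ‖f‖ := by
  refine Lp.norm_le_mul_norm_of_ae_le_mul ?_
  filter_upwards [mulL_ae hm f] with x hx
  rw [hx, norm_mul]
  gcongr
  exact hC x

theorem mulL_sub_left {m k : ℝ → ℂ} (hm : MemLp m ∞ (volume : Measure ℝ))
    (hk : MemLp k ∞ (volume : Measure ℝ)) (f : L2) :
    mulL (fun x => m x - k x) f = mulL m f - mulL k f := by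
  refine mulL_eq_of_ae (hm.sub hk) ?_
  filter_upwards [mulL_ae hm f, mulL_ae hk f, Lp.coeFn_sub (mulL m f) (mulL k f)] with x hm hk hsub
  rw [hsub, Pi.sub_apply, hm, hk]
  exact (sub_mul _ _ _).symm

/-- Translation `f ↦ f(· + a)` on `L²`. -/
def shift (a : ℝ) : L2 →ₗᵢ[ℂ] L2 :=
  Lp.compMeasurePreservingₗᵢ ℂ (fun x => x + a) (measurePreserving_add_right volume a)

theorem shift_ae (a : ℝ) (f : L2) : shift a f =ᵐ[volume] fun x => f (x + a) :=
  Lp.coeFn_compMeasurePreserving f (measurePreserving_add_right volume a)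

theorem ae_add_const {p : ℝ → Prop} (a : ℝ) (h : ∀ᵐ x : ℝ, p x) : ∀ᵐ x : ℝ, p (x + a) :=
  (measurePreserving_add_right (volume : Measure ℝ) a).quasiMeasurePreserving.ae h

/-- Reflection `f ↦ f(-·)` on `L²`. -/
def refl : L2 →ₗᵢ[ℂ] L2 :=
  Lp.compMeasurePreservingₗᵢ ℂ (fun x => -x) (Measure.measurePreserving_neg volume)

theorem refl_ae (f : L2) : refl f =ᵐ[volume] fun x => f (-x) :=
  Lp.coeFn_compMeasurePreserving f (Measure.measurePreserving_neg volume)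

theorem ae_neg {p : ℝ → Prop} (h : ∀ᵐ x : ℝ, p x) : ∀ᵐ x : ℝ, p (-x) :=
  (Measure.measurePreserving_neg (volume : Measure ℝ)).quasiMeasurePreserving.ae h

theorem mem_evenL2_iff (f : L2) : f ∈ evenL2 ↔ refl f = f := by
  change (∀ᵐ x : ℝ, f (-x) = f x) ↔ _
  rw [Lp.ext_iff]
  constructor
  · intro h
    filter_upwards [h, refl_ae f] with x hx hr
    rw [hr, hx]
  · intro h
    filter_upwards [h, refl_ae f] with x hx hr
    rw [← hr, hx]

theorem integrable_schwartz_mul (ψ : 𝓢(ℝ, ℂ)) (u : L2) : Integrable fun x => ψ x * u x :=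
  MemLp.integrable_mul (ψ.memLp 2 volume) (Lp.memLp u)

theorem HasWeakDeriv.mulL {m : ℝ → ℂ} (hm : BddSmooth m) {f g : L2} (h : HasWeakDeriv f g) :
    HasWeakDeriv (mulL m f) (mulL m g + MonatomicFPUT.mulL (deriv m) f) := by
  have hm' : BddSmooth (deriv m) := hm.of_hasDerivAt hm.hasDerivAt
  rw [hasWeakDeriv_iff_integral] at *
  intro φ
  set ψ := SchwartzMap.smulLeftCLM ℂ m φ
  have ψ_eq (x : ℝ) : ψ x = m x * φ x := by
    rw [SchwartzMap.smulLeftCLM_apply_apply hm.hasTemperateGrowth, smul_eq_mul]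
  have deriv_ψ (x : ℝ) : deriv ψ x = deriv m x * φ x + m x * deriv φ x := by
    rw [show (ψ : ℝ → ℂ) = fun x => m x * φ x from funext ψ_eq]
    exact ((hm.hasDerivAt x).mul φ.differentiableAt.hasDerivAt).deriv
  have key := h ψ
  simp only [ψ_eq, deriv_ψ] at key
  have left : ∫ x, φ x * (MonatomicFPUT.mulL m g + MonatomicFPUT.mulL (deriv m) f : L2) x =
      (∫ x, m x * φ x * g x) + ∫ x, φ x * (MonatomicFPUT.mulL (deriv m) f) x := by
    rw [← integral_add ((integrable_schwartz_mul ψ g).congr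
      (Eventually.of_forall fun x => by simp only [ψ_eq])) (integrable_schwartz_mul φ _)]
    refine integral_congr_ae ?_
    filter_upwards [Lp.coeFn_add (MonatomicFPUT.mulL m g) (MonatomicFPUT.mulL (deriv m) f),
      mulL_ae hm.memLp_top g] with x hadd hg
    rw [hadd, Pi.add_apply, hg]
    ring
  have right : ∫ x, (deriv m x * φ x + m x * deriv φ x) * f x =
      (∫ x, φ x * (MonatomicFPUT.mulL (deriv m) f) x) +
        ∫ x, deriv φ x * (MonatomicFPUT.mulL m f) x := by
    have hφ' : Integrable fun x => deriv φ x * (MonatomicFPUT.mulL m f) x :=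
      integrable_schwartz_mul (SchwartzMap.derivCLM ℂ ℂ φ) _
    rw [← integral_add (integrable_schwartz_mul φ _) hφ']
    refine integral_congr_ae ?_
    filter_upwards [mulL_ae hm.memLp_top f, mulL_ae hm'.memLp_top f] with x hf hf'
    rw [hf, hf']
    ring
  rw [left, key, right]
  ring

theorem HasWeakDeriv.shift (a : ℝ) {f g : L2} (h : HasWeakDeriv f g) :
    HasWeakDeriv (shift a f) (shift a g) := by
  rw [hasWeakDeriv_iff_integral] at *
  intro φ
  let ψ : 𝓢(ℝ, ℂ) := SchwartzMap.compCLMOfAntilipschitz ℂ (g := fun x : ℝ => x + -a) (K := 1)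
    (by fun_prop) (AntilipschitzWith.of_le_mul_dist fun x y => by simp) φ
  have ψ_eq (x : ℝ) : ψ x = φ (x + -a) := rfl
  have deriv_ψ (x : ℝ) : deriv ψ x = deriv φ (x + -a) := deriv_comp_add_const ..
  have key := h ψ
  simp only [ψ_eq, deriv_ψ] at key
  rw [← integral_add_right_eq_self _ a, ← integral_add_right_eq_self (fun x => _ * f x) a] at key
  simp only [add_neg_cancel_right] at key
  rw [integral_congr_ae (g := fun x => φ x * g (x + a)), key, neg_inj]
  · refine integral_congr_ae ?_
    filter_upwards [shift_ae a f] with x hx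
    rw [hx]
  · filter_upwards [shift_ae a g] with x hx
    rw [hx]

theorem HasWeakDeriv.refl {f g : L2} (h : HasWeakDeriv f g) :
    HasWeakDeriv (refl f) (-refl g) := by
  rw [hasWeakDeriv_iff_integral] at *
  intro φ
  let ψ : 𝓢(ℝ, ℂ) := SchwartzMap.compCLMOfAntilipschitz ℂ (g := fun x : ℝ => -x) (K := 1)
    (by fun_prop) (AntilipschitzWith.of_le_mul_dist fun x y => by simp) φ
  have ψ_eq (x : ℝ) : ψ x = φ (-x) := rfl
  have deriv_ψ (x : ℝ) : deriv ψ x = -deriv φ (-x) := deriv_comp_neg ..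
  have key := h ψ
  simp only [ψ_eq, deriv_ψ] at key
  rw [← integral_neg_eq_self, ← integral_neg_eq_self (fun x => _ * f x)] at key
  simp only [neg_neg] at key
  rw [integral_congr_ae (g := fun x => -(φ x * g (-x))), integral_neg, key, ← integral_neg,
    ← integral_neg, ← integral_neg]
  · refine integral_congr_ae ?_
    filter_upwards [refl_ae f] with x hx
    rw [hx]; ring
  · filter_upwards [refl_ae g, Lp.coeFn_neg (MonatomicFPUT.refl g)] with x hx hneg
    rw [hneg, Pi.neg_apply, hx]; ring

theorem refl_weakDeriv {f : L2} (hf : f ∈ sobolev 1) :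
    weakDeriv (refl f) = -refl (weakDeriv f) :=
  (hasWeakDeriv_weakDeriv hf).refl.weakDeriv_eq

theorem weakDeriv_mulL {m m' : ℝ → ℂ} (hm : BddSmooth m) (hd : ∀ x, HasDerivAt m (m' x) x)
    {f : L2} (hf : f ∈ sobolev 1) :
    weakDeriv (mulL m f) = mulL m (weakDeriv f) + mulL m' f := by
  rw [((hasWeakDeriv_weakDeriv hf).mulL hm).weakDeriv_eq,
    show deriv m = m' from funext fun x => (hd x).deriv]

theorem mulL_mem_sobolev_one {m : ℝ → ℂ} (hm : BddSmooth m) {f : L2} (hf : f ∈ sobolev 1) :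
    mulL m f ∈ sobolev 1 :=
  ((hasWeakDeriv_weakDeriv hf).mulL hm).mem_sobolev_one

/-! ### Operators bounded between Sobolev spaces -/

/-- `T` maps `H^s` boundedly into `H^t`. Linearity is not part of the notion, since the operators
of interest are linear only on the subspace where the weak derivatives exist. -/
def SobolevBdd (s t : ℝ) (T : L2 → L2) : Prop :=
  ∃ C : ℝ≥0, ∀ U ∈ sobolev s, T U ∈ sobolev t ∧ sobolevENorm t (T U) ≤ C * sobolevENorm s U

namespace SobolevBdd

variable {s t u : ℝ} {T S : L2 → L2}

theorem add (hT : SobolevBdd s t T) (hS : SobolevBdd s t S) :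
    SobolevBdd s t fun U => T U + S U := by
  obtain ⟨C, hC⟩ := hT
  obtain ⟨C', hC'⟩ := hS
  refine ⟨C + C', fun U hU => ⟨add_mem (hC U hU).1 (hC' U hU).1, ?_⟩⟩
  refine (sobolevENorm_add_le _ _ _).trans ?_
  rw [ENNReal.coe_add, add_mul]
  exact add_le_add (hC U hU).2 (hC' U hU).2

theorem smul (a : ℂ) (hT : SobolevBdd s t T) : SobolevBdd s t fun U => a • T U := by
  obtain ⟨C, hC⟩ := hT
  refine ⟨‖a‖₊ * C, fun U hU => ⟨Submodule.smul_mem _ _ (hC U hU).1, ?_⟩⟩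
  rw [sobolevENorm_smul, ENNReal.coe_mul, mul_assoc]
  exact mul_le_mul_right (hC U hU).2 _

theorem sub (hT : SobolevBdd s t T) (hS : SobolevBdd s t S) :
    SobolevBdd s t fun U => T U - S U := by
  simpa only [neg_one_smul, ← sub_eq_add_neg] using hT.add (hS.smul (-1))

theorem comp (hS : SobolevBdd t u S) (hT : SobolevBdd s t T) :
    SobolevBdd s u fun U => S (T U) := by
  obtain ⟨C, hC⟩ := hT
  obtain ⟨C', hC'⟩ := hS
  refine ⟨C' * C, fun U hU => ⟨(hC' _ (hC U hU).1).1, (hC' _ (hC U hU).1).2.trans ?_⟩⟩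
  rw [ENNReal.coe_mul, mul_assoc]
  exact mul_le_mul_right (hC U hU).2 _

protected theorem id (h : t ≤ s) : SobolevBdd s t fun U => U :=
  ⟨1, fun U hU => ⟨sobolev_anti h hU, by simpa using sobolevENorm_mono h U⟩⟩

protected theorem weakDeriv (hs : 0 ≤ s) : SobolevBdd (s + 1) s weakDeriv :=
  ⟨1, fun U hU => ⟨weakDeriv_mem_sobolev hs hU, by
    simpa using sobolevENorm_weakDeriv_le s (sobolev_anti (by linarith) hU)⟩⟩

theorem succ_of_hasWeakDeriv (ht : 0 ≤ t) (hT : SobolevBdd s t T) (hS : SobolevBdd s t S)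
    (h : ∀ U ∈ sobolev s, HasWeakDeriv (T U) (S U)) : SobolevBdd s (t + 1) T := by
  obtain ⟨C, hC⟩ := hT
  obtain ⟨C', hC'⟩ := hS
  refine ⟨C + C', fun U hU => ⟨(h U hU).mem_sobolev_succ ht (hC U hU).1 (hC' U hU).1, ?_⟩⟩
  refine ((h U hU).sobolevENorm_succ_le t).trans ?_
  rw [ENNReal.coe_add, add_mul]
  exact add_le_add (hC U hU).2 (hC' U hU).2

theorem succ_of_commutator (hs : 0 ≤ s) (hT : SobolevBdd s s T) (hS : SobolevBdd s s S)
    (h : ∀ f g, HasWeakDeriv f g → HasWeakDeriv (T f) (T g + S f)) :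
    SobolevBdd (s + 1) (s + 1) T := by
  have incl : SobolevBdd (s + 1) s fun U => U := .id (by linarith)
  exact succ_of_hasWeakDeriv hs (hT.comp incl)
    ((hT.comp (.weakDeriv hs)).add (hS.comp incl))
    fun U hU => h _ _ (hasWeakDeriv_weakDeriv (sobolev_anti (by linarith) hU))

theorem zero_of_norm_le {C : ℝ≥0} (h : ∀ U, ‖T U‖ ≤ C * ‖U‖) : SobolevBdd 0 0 T := by
  refine ⟨C, fun U _ => ⟨mem_sobolev_zero _, ?_⟩⟩
  rw [sobolevENorm_zero_left, sobolevENorm_zero_left]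
  rw [← ofReal_norm, ← ofReal_norm, ← ENNReal.ofReal_coe_nnreal, ← ENNReal.ofReal_mul C.coe_nonneg]
  exact ENNReal.ofReal_le_ofReal (h U)

protected theorem mulL {m : ℝ → ℂ} (hm : BddSmooth m) (n : ℕ) : SobolevBdd n n (mulL m) := by
  induction n generalizing m with
  | zero =>
    obtain ⟨C, hC⟩ := hm.bdd
    have hC0 : 0 ≤ C := (norm_nonneg _).trans (hC 0)
    exact_mod_cast zero_of_norm_le (C := ⟨C, hC0⟩) (norm_mulL_le hm.memLp_top hC)
  | succ n ih =>
    push_cast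
    exact succ_of_commutator n.cast_nonneg (ih hm) (ih (hm.of_hasDerivAt hm.hasDerivAt))
      fun _ _ h => h.mulL hm

protected theorem shift (a : ℝ) (n : ℕ) : SobolevBdd n n (shift a) := by
  induction n with
  | zero => exact_mod_cast zero_of_norm_le (C := 1) fun U => by simp
  | succ n ih =>
    push_cast
    exact succ_of_commutator n.cast_nonneg ih (S := fun _ => 0)
      ⟨0, fun _ _ => ⟨zero_mem _, by simp [sobolevENorm]⟩⟩
      fun _ _ h => by simpa using h.shift a

end SobolevBdd

/-! ### Sobolev embedding -/

theorem continuous_fourier_of_integrable {f : ℝ → ℂ} (hf : Integrable f) : Continuous (𝓕 f) := by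
  rw [← Real.fourierTransform_toLp (memLp_one_iff_integrable.2 hf)]
  exact BoundedContinuousFunction.continuous _

theorem continuous_fourierInv_of_integrable {f : ℝ → ℂ} (hf : Integrable f) :
    Continuous (𝓕⁻ f) := by
  rw [Real.fourierInv_eq_fourier_comp_neg]
  exact continuous_fourier_of_integrable hf.comp_neg

theorem integral_fourier_schwartz_mul (φ : 𝓢(ℝ, ℂ)) {f : ℝ → ℂ} (hf : Integrable f) :
    ∫ x, (𝓕 φ) x * f x = ∫ x, φ x * 𝓕 f x := by
  rw [SchwartzMap.fourier_coe]
  have := VectorFourier.integral_fourierIntegral_smul_eq_flip (L := innerₗ ℝ)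
    Real.continuous_fourierChar continuous_inner (φ.integrable (μ := volume)) hf
  rwa [flip_innerₗ] at this

theorem integral_fourierInv_schwartz_mul (φ : 𝓢(ℝ, ℂ)) {f : ℝ → ℂ} (hf : Integrable f) :
    ∫ x, (𝓕⁻ φ) x * f x = ∫ x, φ x * 𝓕⁻ f x := by
  rw [Real.fourierInv_eq_fourier_comp_neg, ← integral_fourier_schwartz_mul φ hf.comp_neg,
    ← integral_neg_eq_self fun x => (𝓕 φ : 𝓢(ℝ, ℂ)) x * f (-x)]
  simp only [neg_neg, SchwartzMap.fourierInv_coe, SchwartzMap.fourier_coe,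
    Real.fourierInv_eq_fourier_neg]

theorem fourier_ae_of_integrable {f : L2} (hf : Integrable f volume) :
    (𝓕 f : L2) =ᵐ[volume] 𝓕 (f : ℝ → ℂ) := by
  refine ae_eq_of_integral_schwartz_mul_eq (locallyIntegrable_coe _)
    (continuous_fourier_of_integrable hf).locallyIntegrable fun φ => ?_
  rw [← integral_fourier_schwartz_mul φ hf]
  have h := DFunLike.congr_fun (Lp.fourier_toTemperedDistribution_eq f) φ
  rw [TemperedDistribution.fourier_apply, Lp.toTemperedDistribution_apply,
    Lp.toTemperedDistribution_apply] at h
  exact h.symm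

theorem fourierInv_ae_of_integrable {f : L2} (hf : Integrable f volume) :
    (𝓕⁻ f : L2) =ᵐ[volume] 𝓕⁻ (f : ℝ → ℂ) := by
  refine ae_eq_of_integral_schwartz_mul_eq (locallyIntegrable_coe _)
    (continuous_fourierInv_of_integrable hf).locallyIntegrable fun φ => ?_
  rw [← integral_fourierInv_schwartz_mul φ hf]
  have h := DFunLike.congr_fun (Lp.fourierInv_toTemperedDistribution_eq f) φ
  rw [TemperedDistribution.fourierInv_apply, Lp.toTemperedDistribution_apply,
    Lp.toTemperedDistribution_apply] at h
  exact h.symm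

theorem HasWeakDeriv.integral_eq_zero {f g : L2} (h : HasWeakDeriv f g)
    (hf : Integrable f volume) (hg : Integrable g volume) : ∫ x, g x = 0 := by
  have symbol : 𝓕 (g : ℝ → ℂ) = fun ξ => derivSymbol ξ * 𝓕 (f : ℝ → ℂ) ξ := by
    refine ((continuous_fourier_of_integrable hg).ae_eq_iff_eq volume ?_).1 ?_
    · exact (by unfold derivSymbol; fun_prop : Continuous derivSymbol).mul
        (continuous_fourier_of_integrable hf)
    · filter_upwards [hasWeakDeriv_iff_fourier.1 h, fourier_ae_of_integrable hf,
        fourier_ae_of_integrable hg] with ξ hξ hfξ hgξ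
      rw [← hgξ, hξ, hfξ]
  simpa [Real.fourier_eq, derivSymbol] using congrFun symbol 0

theorem integrable_fourier_of_mem_sobolev_one {f : L2} (hf : f ∈ sobolev 1) :
    Integrable (𝓕 f : L2) volume := by
  have weight : MemLp (fun ξ => (sobolevWeight (-1) ξ : ℂ)) 2 volume := by
    refine (memLp_two_iff_integrable_sq_norm ?_).2 ?_
    · exact (Complex.continuous_ofReal.comp (continuous_sobolevWeight _)).aestronglyMeasurable
    · have (ξ : ℝ) : ‖(sobolevWeight (-1) ξ : ℂ)‖ ^ 2 = (1 + (2 * Real.pi * ξ) ^ 2)⁻¹ := by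
        rw [Complex.norm_real, Real.norm_of_nonneg (sobolevWeight_pos _ _).le, sobolevWeight,
          ← Real.rpow_natCast, ← Real.rpow_mul (by positivity), ← Real.rpow_neg_one]
        norm_num
      simp only [this]
      exact integrable_inv_one_add_sq.comp_mul_left' (by positivity)
  have hf' := (mem_sobolev_iff zero_le_one f).1 hf
  refine (weight.integrable_mul ⟨aestronglyMeasurable_sobolevWeight_mul 1 f, hf'⟩).congr
    (Eventually.of_forall fun ξ => ?_)
  rw [Pi.mul_apply, ← mul_assoc, ← Complex.ofReal_mul, ← sobolevWeight_add]
  simp [sobolevWeight]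

/-- The continuous representative of `f ∈ H¹`, given by Fourier inversion. -/
def contRep (f : L2) : ℝ → ℂ := 𝓕⁻ ((𝓕 f : L2) : ℝ → ℂ)

theorem continuous_contRep {f : L2} (hf : f ∈ sobolev 1) : Continuous (contRep f) :=
  continuous_fourierInv_of_integrable (integrable_fourier_of_mem_sobolev_one hf)

theorem contRep_ae {f : L2} (hf : f ∈ sobolev 1) : f =ᵐ[volume] contRep f := by
  have h := fourierInv_ae_of_integrable (integrable_fourier_of_mem_sobolev_one hf)
  rwa [FourierTransform.fourierInv_fourier_eq] at h

theorem exists_norm_contRep_le (f : L2) : ∃ C : ℝ, ∀ x, ‖contRep f x‖ ≤ C :=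
  ⟨∫ ξ, ‖(𝓕 f : L2) ξ‖, fun _ => VectorFourier.norm_fourierIntegral_le_integral_norm ..⟩

theorem hasDerivAt_contRep {f : L2} (hf : f ∈ sobolev 2) (x : ℝ) :
    HasDerivAt (contRep f) (contRep (weakDeriv f) x) x := by
  have hf₁ := sobolev_anti one_le_two hf
  have hi := integrable_fourier_of_mem_sobolev_one hf₁
  have hi' := integrable_fourier_of_mem_sobolev_one (weakDeriv_mem_sobolev_one hf)
  have symbol := hasWeakDeriv_iff_fourier.1 (hasWeakDeriv_weakDeriv hf₁)
  unfold contRep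
  rw [Real.fourierInv_eq_fourier_comp_neg, Real.fourierInv_eq_fourier_comp_neg]
  have symbol_neg : (fun ξ => (𝓕 (weakDeriv f) : L2) (-ξ)) =ᵐ[volume]
      fun ξ => (-2 * Real.pi * Complex.I * ξ) • (𝓕 f : L2) (-ξ) := by
    filter_upwards [ae_neg symbol] with ξ hξ
    rw [hξ, derivSymbol, smul_eq_mul]
    push_cast
    ring
  rw [Real.fourier_congr_ae symbol_neg]
  refine Real.hasDerivAt_fourier hi.comp_neg ?_ x
  refine (hi'.comp_neg.const_mul (-2 * Real.pi * Complex.I)⁻¹).congr ?_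
  filter_upwards [symbol_neg] with ξ hξ
  rw [hξ, smul_eq_mul, Complex.real_smul]
  field_simp

theorem contRep_neg {f : L2} (hf : f ∈ sobolev 1) (he : f ∈ evenL2) (x : ℝ) :
    contRep f (-x) = contRep f x := by
  have h : (fun x => contRep f (-x)) =ᵐ[volume] contRep f := by
    filter_upwards [contRep_ae hf, ae_neg (contRep_ae hf), show ∀ᵐ x : ℝ, f (-x) = f x from he]
      with x hx hnx hex
    rw [← hx, ← hnx, hex]
  have hc := continuous_contRep hf
  exact congrFun (((hc.comp continuous_neg).ae_eq_iff_eq volume hc).1 h) x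

theorem hasWeakDeriv_of_hasDerivAt {f g : L2} {s s' : ℝ → ℂ} (hf : f =ᵐ[volume] s)
    (hg : g =ᵐ[volume] s') (hd : ∀ x, HasDerivAt s (s' x) x) : HasWeakDeriv f g := by
  refine hasWeakDeriv_iff_integral.2 fun φ => ?_
  have mul_f (ψ : 𝓢(ℝ, ℂ)) : (fun x => ψ x * f x) =ᵐ[volume] fun x => ψ x * s x := by
    filter_upwards [hf] with x hx using by rw [hx]
  have mul_g : (fun x => φ x * g x) =ᵐ[volume] fun x => φ x * s' x := by
    filter_upwards [hg] with x hx using by rw [hx]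
  have mul_deriv := mul_f (SchwartzMap.derivCLM ℂ ℂ φ)
  rw [integral_congr_ae mul_g, show ∫ x, deriv φ x * f x = _ from integral_congr_ae mul_deriv]
  exact integral_mul_deriv_eq_deriv_mul_of_integrable
    (fun x _ => φ.differentiableAt.hasDerivAt) (fun x _ => hd x)
    ((integrable_schwartz_mul φ g).congr mul_g)
    ((integrable_schwartz_mul _ f).congr mul_deriv) ((integrable_schwartz_mul φ f).congr (mul_f φ))

/-! ### Smoothness of the travelling wave -/

section TravelingWave

variable {c : ℝ} {ς : L2}

theorem IsTravelingWave.secondDeriv_ae (hc : c ≠ 0) (hw : IsTravelingWave c ς)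
    (h1 : ς ∈ sobolev 1) :
    secondDeriv ς =ᵐ[volume] fun x => -((c : ℂ) ^ 2)⁻¹ *
      twoSubA (fun y => contRep ς y + contRep ς y ^ 2) x := by
  have hc' : (c : ℂ) ≠ 0 := by exact_mod_cast hc
  have h := contRep_ae h1
  filter_upwards [hw, h, ae_add_const 1 h, ae_add_const (-1) h] with x hx h0 h1 h2
  simp only [twoSubA, sub_eq_add_neg x 1, h0, h1, h2] at hx ⊢
  field_simp
  linear_combination hx

theorem BddContDiff.twoSubA {n : ℕ∞} {m : ℝ → ℂ} (hm : BddContDiff n m) :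
    BddContDiff n (twoSubA m) :=
  (hm.const_mul 2).sub ((hm.comp_add_const 1).add
    (by simpa only [sub_eq_add_neg] using hm.comp_add_const (-1)))

theorem hasDerivAt_twoSubA {m m' : ℝ → ℂ} (hm : ∀ x, HasDerivAt m (m' x) x) (x : ℝ) :
    HasDerivAt (twoSubA m) (twoSubA m' x) x :=
  ((hm x).const_mul 2).sub
    (((hm (x + 1)).comp_add_const x 1).add ((hm (x - 1)).comp_sub_const x 1))

theorem memLp_twoSubA {m : ℝ → ℂ} (hm : MemLp m 2 volume) : MemLp (twoSubA m) 2 volume :=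
  (hm.const_mul 2).sub ((hm.comp_measurePreserving (measurePreserving_add_right volume 1)).add
    (hm.comp_measurePreserving (measurePreserving_sub_right volume 1)))

theorem hasDerivAt_contRep_add_sq (h2 : ς ∈ sobolev 2) (x : ℝ) :
    HasDerivAt (fun y => contRep ς y + contRep ς y ^ 2)
      ((1 + 2 * contRep ς x) * contRep (weakDeriv ς) x) x := by
  have h := hasDerivAt_contRep h2 x
  exact (h.add (h.pow 2)).congr_deriv (by push_cast; ring)

theorem IsTravelingWave.weakDeriv_weakDeriv_mem (hc : c ≠ 0) (hw : IsTravelingWave c ς)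
    (h2 : ς ∈ sobolev 2) : weakDeriv (weakDeriv ς) ∈ sobolev 1 := by
  have h1 := sobolev_anti one_le_two h2
  obtain ⟨C, hC⟩ := exists_norm_contRep_le ς
  have memLp : MemLp (fun y => (1 + 2 * contRep ς y) * contRep (weakDeriv ς) y) 2 volume := by
    have hp := weakDeriv_mem_sobolev_one h2
    refine MemLp.of_le_mul (c := 1 + 2 * C) ((memLp_congr_ae (contRep_ae hp)).1 (Lp.memLp _)) ?_
      (Eventually.of_forall fun y => ?_)
    · exact ((continuous_const.add (continuous_const.mul (continuous_contRep h1))).mul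
        (continuous_contRep hp)).aestronglyMeasurable
    · rw [norm_mul]
      gcongr
      refine norm_add_le_of_le norm_one.le ?_
      rw [norm_mul, Complex.norm_two]
      gcongr
      exact hC y
  have memLp' := (memLp_twoSubA memLp).const_mul (-((c : ℂ) ^ 2)⁻¹)
  rw [← secondDeriv_eq h2]
  exact (hasWeakDeriv_of_hasDerivAt (hw.secondDeriv_ae hc h1) memLp'.coeFn_toLp fun x =>
    (hasDerivAt_twoSubA (hasDerivAt_contRep_add_sq h2) x).const_mul _).mem_sobolev_one

theorem IsTravelingWave.bddSmooth_contRep (hc : c ≠ 0) (hw : IsTravelingWave c ς)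
    (h2 : ς ∈ sobolev 2) : BddSmooth (contRep ς) := by
  have h1 := sobolev_anti one_le_two h2
  have hv := hw.weakDeriv_weakDeriv_mem hc h2
  have v_mem : weakDeriv ς ∈ sobolev 2 := by
    have h := (hasWeakDeriv_weakDeriv (weakDeriv_mem_sobolev_one h2)).mem_sobolev_succ zero_le_one
      (weakDeriv_mem_sobolev_one h2) hv
    norm_num at h
    exact h
  have equation : contRep (weakDeriv (weakDeriv ς)) = fun x => -((c : ℂ) ^ 2)⁻¹ *
      twoSubA (fun y => contRep ς y + contRep ς y ^ 2) x := by
    refine ((continuous_contRep hv).ae_eq_iff_eq volume ?_).1 ?_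
    · exact continuous_const.mul (continuous_iff_continuousAt.2 fun x =>
        (hasDerivAt_twoSubA (hasDerivAt_contRep_add_sq h2) x).continuousAt)
    · refine (contRep_ae hv).symm.trans ?_
      rw [← secondDeriv_eq h2]
      exact hw.secondDeriv_ae hc h1
  have bootstrap (j : ℕ) : BddContDiff j (contRep ς) ∧ BddContDiff j (contRep (weakDeriv ς)) := by
    induction j with
    | zero =>
      exact ⟨BddContDiff.zero_iff.2 ⟨continuous_contRep h1, exists_norm_contRep_le _⟩,
        BddContDiff.zero_iff.2 ⟨continuous_contRep (weakDeriv_mem_sobolev_one h2),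
          exists_norm_contRep_le _⟩⟩
    | succ j ih =>
      have hn : BddContDiff j fun y => contRep ς y + contRep ς y ^ 2 := by
        simpa only [sq] using ih.1.add (ih.1.mul ih.1)
      have hv' : BddContDiff j (contRep (weakDeriv (weakDeriv ς))) := by
        rw [equation]
        exact hn.twoSubA.const_mul _
      exact ⟨.succ_of_hasDerivAt (exists_norm_contRep_le _) (hasDerivAt_contRep h2) ih.2,
        .succ_of_hasDerivAt (exists_norm_contRep_le _) (hasDerivAt_contRep v_mem) hv'⟩
  exact BddContDiff.top_of_forall_nat fun j => (bootstrap j).1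

end TravelingWave

/-! ### Hyperbolic weights -/

/-- The weight `cosh^q` of the spaces `H_q^r`, as a complex-valued function; `coshPow (-q)` is the
function in the kernel of the adjoint of the conjugated operator. -/
def coshPow (q x : ℝ) : ℂ := (Real.cosh x ^ q : ℝ)

/-- The ratio of weights `cosh(x)^q / cosh(x + a)^q`, which conjugates the translation by `a`. -/
def weightRatio (q a x : ℝ) : ℂ := coshPow q x * coshPow (-q) (x + a)

/-- The zeroth order coefficient `cosh^q (cosh^{-q})''` of the conjugated second derivative. -/
def potential (q x : ℝ) : ℂ := q * (q + 1) * (Real.tanh x : ℂ) ^ 2 - q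

theorem hasDerivAt_tanh (x : ℝ) :
    HasDerivAt (fun y => (Real.tanh y : ℂ)) (1 - (Real.tanh x : ℂ) ^ 2) x := by
  have hc := (Real.cosh_pos x).ne'
  have h := (Real.hasDerivAt_sinh x).div (Real.hasDerivAt_cosh x) hc
  rw [show Real.sinh / Real.cosh = Real.tanh from
    funext fun y => (Real.tanh_eq_sinh_div_cosh y).symm] at h
  refine h.ofReal_comp.congr_deriv ?_
  rw [Real.tanh_eq_sinh_div_cosh]
  norm_cast
  field_simp

theorem bddSmooth_tanh : BddSmooth fun x => (Real.tanh x : ℂ) := by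
  have bdd : ∃ C : ℝ, ∀ x, ‖(Real.tanh x : ℂ)‖ ≤ C :=
    ⟨1, fun x => (Complex.norm_real _).trans_le (Real.abs_tanh_lt_one x).le⟩
  refine .top_of_forall_nat fun j => ?_
  induction j with
  | zero =>
    have continuous := continuous_iff_continuousAt.2 fun x => (hasDerivAt_tanh x).continuousAt
    exact .zero_iff.2 ⟨continuous, bdd⟩
  | succ j ih =>
    have h : BddContDiff j fun x => 1 - (Real.tanh x : ℂ) ^ 2 := by
      simpa only [sq] using (BddContDiff.const 1).sub (ih.mul ih)
    exact .succ_of_hasDerivAt bdd hasDerivAt_tanh h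

theorem bddSmooth_potential (q : ℝ) : BddSmooth (potential q) := by
  have h := bddSmooth_tanh.mul bddSmooth_tanh
  simp only [← sq] at h
  exact (h.const_mul _).sub (.const _)

theorem coshPow_ne_zero (q x : ℝ) : coshPow q x ≠ 0 :=
  Complex.ofReal_ne_zero.2 (Real.rpow_pos_of_pos (Real.cosh_pos x) _).ne'

theorem norm_coshPow (q x : ℝ) : ‖coshPow q x‖ = Real.cosh x ^ q := by
  rw [coshPow, Complex.norm_real, Real.norm_of_nonneg (Real.rpow_pos_of_pos (Real.cosh_pos x) _).le]

theorem coshPow_zero (x : ℝ) : coshPow 0 x = 1 := by simp [coshPow]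

theorem coshPow_add (p q x : ℝ) : coshPow (p + q) x = coshPow p x * coshPow q x := by
  rw [coshPow, Real.rpow_add (Real.cosh_pos x), Complex.ofReal_mul, ← coshPow, ← coshPow]

theorem coshPow_mul_coshPow_neg (q x : ℝ) : coshPow q x * coshPow (-q) x = 1 := by
  rw [← coshPow_add, add_neg_cancel, coshPow_zero]

theorem coshPow_neg_right (q x : ℝ) : coshPow q (-x) = coshPow q x := by simp [coshPow]

theorem hasDerivAt_coshPow (q x : ℝ) :
    HasDerivAt (coshPow q) (q * Real.tanh x * coshPow q x) x := by
  have hc := (Real.cosh_pos x).ne'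
  refine ((Real.hasDerivAt_cosh x).rpow_const (p := q) (Or.inl hc)).ofReal_comp.congr_deriv ?_
  rw [coshPow, Real.tanh_eq_sinh_div_cosh, Real.rpow_sub_one hc]
  norm_cast
  field_simp

theorem continuous_coshPow (q : ℝ) : Continuous (coshPow q) :=
  continuous_iff_continuousAt.2 fun x => (hasDerivAt_coshPow q x).continuousAt

theorem bddSmooth_coshPow_neg {q : ℝ} (hq : 0 ≤ q) : BddSmooth (coshPow (-q)) := by
  refine .top_of_hasDerivAt_mul (bddSmooth_tanh.const_mul _) ⟨1, fun x => ?_⟩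
    (hasDerivAt_coshPow (-q))
  rw [norm_coshPow]
  exact Real.rpow_le_one_of_one_le_of_nonpos (Real.one_le_cosh x) (neg_nonpos.2 hq)

theorem integrable_coshPow_neg {q : ℝ} (hq : 0 < q) : Integrable (coshPow (-q)) := by
  have decay : coshPow (-q) =O[atTop] fun x => Real.exp (-q * x) := by
    refine Asymptotics.IsBigO.of_bound (2 ^ q) (Eventually.of_forall fun x => ?_)
    have h : Real.exp x / 2 ≤ Real.cosh x := by
      rw [Real.cosh_eq]
      linarith [Real.exp_pos (-x)]
    calc ‖coshPow (-q) x‖ = Real.cosh x ^ (-q) := norm_coshPow _ _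
      _ ≤ (Real.exp x / 2) ^ (-q) :=
        Real.rpow_le_rpow_of_nonpos (by positivity) h (neg_nonpos.2 hq.le)
      _ = 2 ^ q * ‖Real.exp (-q * x)‖ := by
        rw [Real.norm_of_nonneg (Real.exp_pos _).le, Real.div_rpow (Real.exp_pos x).le zero_le_two,
          ← Real.exp_mul, Real.rpow_neg zero_le_two, div_inv_eq_mul, mul_comm, mul_comm x]
  exact (continuous_coshPow _).locallyIntegrable.integrable_of_isBigO_atTop_of_norm_isNegInvariant
    (Eventually.of_forall fun x => by simp only [Function.comp_apply, coshPow_neg_right]) decay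
    ⟨Set.Ioi 0, Ioi_mem_atTop 0, integrableOn_exp_mul_Ioi (neg_neg_iff_pos.2 hq) 0⟩

theorem memLp_coshPow_neg {q : ℝ} (hq : 0 < q) :
    MemLp (coshPow (-q)) 2 (volume : Measure ℝ) := by
  rw [memLp_two_iff_integrable_sq_norm (continuous_coshPow _).aestronglyMeasurable]
  refine (integrable_coshPow_neg (add_pos hq hq)).norm.congr (Eventually.of_forall fun x => ?_)
  change ‖coshPow (-(q + q)) x‖ = ‖coshPow (-q) x‖ ^ 2
  rw [neg_add, coshPow_add, norm_mul, sq]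

theorem coshPow_neg_mul_weightRatio (q a x : ℝ) :
    coshPow (-q) x * weightRatio q a x = coshPow (-q) (x + a) := by
  rw [weightRatio, ← mul_assoc, mul_comm (coshPow (-q) x), coshPow_mul_coshPow_neg, one_mul]

theorem weightRatio_add (p q a x : ℝ) :
    weightRatio (p + q) a x = weightRatio p a x * weightRatio q a x := by
  rw [weightRatio, weightRatio, weightRatio, neg_add, coshPow_add, coshPow_add]
  ring

theorem weightRatio_neg_right (q a x : ℝ) : weightRatio q a (-x) = weightRatio q (-a) x := by
  rw [weightRatio, weightRatio, coshPow_neg_right, ← coshPow_neg_right _ (x + -a), neg_add,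
    neg_neg]

theorem abs_log_cosh_sub_log_cosh_le (x y : ℝ) :
    |Real.log (Real.cosh x) - Real.log (Real.cosh y)| ≤ |x - y| := by
  have hd (z : ℝ) : HasDerivAt (fun z => Real.log (Real.cosh z)) (Real.tanh z) z := by
    rw [Real.tanh_eq_sinh_div_cosh]
    exact (Real.hasDerivAt_cosh z).log (Real.cosh_pos z).ne'
  have h : LipschitzWith 1 fun z => Real.log (Real.cosh z) := by
    refine lipschitzWith_of_nnnorm_deriv_le (fun z => (hd z).differentiableAt) fun z => ?_
    rw [(hd z).deriv]
    exact_mod_cast (Real.abs_tanh_lt_one z).le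
  simpa only [Real.dist_eq, NNReal.coe_one, one_mul] using h.dist_le_mul x y

theorem weightRatio_eq_exp (q a x : ℝ) :
    weightRatio q a x =
      (Real.exp (q * (Real.log (Real.cosh x) - Real.log (Real.cosh (x + a)))) : ℝ) := by
  rw [weightRatio, coshPow, coshPow, ← Complex.ofReal_mul, Real.rpow_def_of_pos (Real.cosh_pos _),
    Real.rpow_def_of_pos (Real.cosh_pos _), ← Real.exp_add]
  congr 2
  ring

theorem norm_weightRatio_sub_one_le (q a x : ℝ) :
    ‖weightRatio q a x - 1‖ ≤ Real.exp (|q| * |a|) - 1 := by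
  set t := q * (Real.log (Real.cosh x) - Real.log (Real.cosh (x + a)))
  have ht : |t| ≤ |q| * |a| := by
    have h := abs_log_cosh_sub_log_cosh_le x (x + a)
    rw [sub_add_cancel_left, abs_neg] at h
    rw [abs_mul]
    gcongr
  have upper : Real.exp t ≤ Real.exp (|q| * |a|) := Real.exp_le_exp.2 ((le_abs_self t).trans ht)
  have lower : Real.exp (-(|q| * |a|)) ≤ Real.exp t :=
    Real.exp_le_exp.2 ((neg_le_neg ht).trans (neg_abs_le t))
  have cosh := Real.one_le_cosh (|q| * |a|)
  rw [Real.cosh_eq] at cosh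
  rw [weightRatio_eq_exp, ← Complex.ofReal_one, ← Complex.ofReal_sub, Complex.norm_real,
    Real.norm_eq_abs, abs_le]
  constructor <;> linarith

theorem norm_weightRatio_le (q a x : ℝ) : ‖weightRatio q a x‖ ≤ Real.exp (|q| * |a|) := by
  have h := norm_add_le_of_le (norm_weightRatio_sub_one_le q a x) norm_one.le
  simpa only [sub_add_cancel] using h

theorem norm_weightRatio_sub_weightRatio_le (p q a x : ℝ) :
    ‖weightRatio q a x - weightRatio p a x‖ ≤
      Real.exp (|p| * |a|) * (Real.exp (|q - p| * |a|) - 1) := by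
  have h : weightRatio q a x - weightRatio p a x =
      weightRatio p a x * (weightRatio (q - p) a x - 1) := by
    rw [mul_sub, mul_one, ← weightRatio_add, add_sub_cancel]
  rw [h, norm_mul]
  exact mul_le_mul (norm_weightRatio_le p a x) (norm_weightRatio_sub_one_le _ a x) (norm_nonneg _)
    (Real.exp_pos _).le

theorem bddSmooth_weightRatio (q a : ℝ) : BddSmooth (weightRatio q a) := by
  refine .top_of_hasDerivAt_mul
    ((bddSmooth_tanh.sub (bddSmooth_tanh.comp_add_const a)).const_mul q)
    ⟨_, norm_weightRatio_le q a⟩ fun x => ?_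
  refine ((hasDerivAt_coshPow q x).mul
    ((hasDerivAt_coshPow (-q) (x + a)).comp_add_const x a)).congr_deriv ?_
  rw [weightRatio]
  push_cast
  ring

/-! ### The conjugated operator -/

section

/-- The operator `cosh^q (2 - A) cosh^{-q}`. -/
def diffOp (q : ℝ) : L2 →L[ℂ] L2 :=
  (2 : ℂ) • ContinuousLinearMap.id ℂ L2 -
    (mulL (weightRatio q 1) ∘L (shift 1).toContinuousLinearMap +
      mulL (weightRatio q (-1)) ∘L (shift (-1)).toContinuousLinearMap)

/-- The terms of order at most one of `conjOp`. -/
def lowerOrder (c : ℝ) (σ : ℝ → ℂ) (q : ℝ) (U : L2) : L2 :=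
  (c : ℂ) ^ 2 • (mulL (potential q) U - (2 * q : ℂ) • mulL (fun x => (Real.tanh x : ℂ))
    (weakDeriv U)) + diffOp q (mulL σ U)

/-- The operator `cosh^q (c² ∂² + (2 - A) σ) cosh^{-q}` on `H²`, which for `σ = 1 + 2ς` is the
conjugate of the linearization by the weight. -/
def conjOp (c : ℝ) (σ : ℝ → ℂ) (q : ℝ) (U : L2) : L2 :=
  (c : ℂ) ^ 2 • weakDeriv (weakDeriv U) + lowerOrder c σ q U

variable {c : ℝ} {σ : ℝ → ℂ} {q : ℝ}

theorem diffOp_apply (q : ℝ) (f : L2) :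
    diffOp q f = (2 : ℂ) • f -
      (mulL (weightRatio q 1) (shift 1 f) + mulL (weightRatio q (-1)) (shift (-1) f)) :=
  rfl

theorem mulL_shift_ae {m : ℝ → ℂ} (hm : MemLp m ∞ (volume : Measure ℝ)) (a : ℝ) (f : L2) :
    mulL m (shift a f) =ᵐ[volume] fun x => m x * f (x + a) := by
  filter_upwards [mulL_ae hm (shift a f), shift_ae a f] with x hm hs
  rw [hm, hs]

theorem diffOp_ae (q : ℝ) (f : L2) :
    diffOp q f =ᵐ[volume] fun x =>
      2 * f x - (weightRatio q 1 x * f (x + 1) + weightRatio q (-1) x * f (x + -1)) := by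
  rw [diffOp_apply]
  filter_upwards [mulL_shift_ae (bddSmooth_weightRatio q 1).memLp_top 1 f,
    mulL_shift_ae (bddSmooth_weightRatio q (-1)).memLp_top (-1) f,
    Lp.coeFn_sub ((2 : ℂ) • f)
      (mulL (weightRatio q 1) (shift 1 f) + mulL (weightRatio q (-1)) (shift (-1) f)),
    Lp.coeFn_add (mulL (weightRatio q 1) (shift 1 f)) (mulL (weightRatio q (-1)) (shift (-1) f)),
    Lp.coeFn_smul (2 : ℂ) f] with x hpos hneg hsub hadd hsmul
  rw [hsub, Pi.sub_apply, hadd, Pi.add_apply, hsmul, Pi.smul_apply, smul_eq_mul, hpos, hneg]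

theorem mulL_coshPow_neg_diffOp (hq : 0 ≤ q) (f : L2) :
    mulL (coshPow (-q)) (diffOp q f) =ᵐ[volume] twoSubA (mulL (coshPow (-q)) f) := by
  have hw := mulL_ae (bddSmooth_coshPow_neg hq).memLp_top f
  filter_upwards [mulL_ae (bddSmooth_coshPow_neg hq).memLp_top (diffOp q f), diffOp_ae q f, hw,
    ae_add_const 1 hw, ae_add_const (-1) hw] with x h hd h0 hpos hneg
  rw [h, hd, twoSubA, sub_eq_add_neg x 1, h0, hpos, hneg]
  linear_combination (-f (x + 1)) * coshPow_neg_mul_weightRatio q 1 x -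
    f (x + -1) * coshPow_neg_mul_weightRatio q (-1) x

theorem refl_shift (a : ℝ) (f : L2) : refl (shift a f) = shift (-a) (refl f) := by
  ext1
  filter_upwards [refl_ae (shift a f), shift_ae (-a) (refl f), ae_add_const (-a) (refl_ae f),
    ae_neg (shift_ae a f)] with x hr hs hf hx
  rw [hr, hs, hf, hx]
  congr 1
  ring

theorem refl_mulL {m k : ℝ → ℂ} (hm : MemLp m ∞ (volume : Measure ℝ))
    (hk : MemLp k ∞ (volume : Measure ℝ)) (h : ∀ x, m (-x) = k x) (f : L2) :
    refl (mulL m f) = mulL k (refl f) := by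
  refine (mulL_eq_of_ae hk ?_).symm
  filter_upwards [refl_ae (mulL m f), refl_ae f, ae_neg (mulL_ae hm f)] with x hr hf hx
  rw [hr, hx, h, hf]

theorem refl_diffOp (q : ℝ) (f : L2) : refl (diffOp q f) = diffOp q (refl f) := by
  have h (a : ℝ) : refl (mulL (weightRatio q a) (shift a f)) =
      mulL (weightRatio q (-a)) (shift (-a) (refl f)) := by
    rw [refl_mulL (bddSmooth_weightRatio q a).memLp_top (bddSmooth_weightRatio q (-a)).memLp_top
      (weightRatio_neg_right q a), refl_shift]
  rw [diffOp_apply, diffOp_apply, map_sub, map_add, map_smul, h, h, neg_neg, add_comm]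

theorem refl_mulL_of_odd {m : ℝ → ℂ} (hm : MemLp m ∞ (volume : Measure ℝ))
    (h : ∀ x, m (-x) = -m x) (f : L2) : refl (mulL m f) = mulL m (-refl f) := by
  refine (mulL_eq_of_ae hm ?_).symm
  filter_upwards [refl_ae (mulL m f), refl_ae f, Lp.coeFn_neg (refl f), ae_neg (mulL_ae hm f)]
    with x hr hf hneg hx
  rw [hr, hx, h, hneg, Pi.neg_apply, hf, neg_mul_comm]

theorem weakDeriv_add {f g : L2} (hf : f ∈ sobolev 1) (hg : g ∈ sobolev 1) :
    weakDeriv (f + g) = weakDeriv f + weakDeriv g :=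
  ((hasWeakDeriv_weakDeriv hf).add (hasWeakDeriv_weakDeriv hg)).weakDeriv_eq

theorem weakDeriv_smul (a : ℂ) {f : L2} (hf : f ∈ sobolev 1) :
    weakDeriv (a • f) = a • weakDeriv f :=
  ((hasWeakDeriv_weakDeriv hf).smul a).weakDeriv_eq

theorem refl_weakDeriv_weakDeriv {U : L2} (hU : U ∈ sobolev 2) :
    refl (weakDeriv (weakDeriv U)) = weakDeriv (weakDeriv (refl U)) := by
  have h := (hasWeakDeriv_weakDeriv (weakDeriv_mem_sobolev_one hU)).refl.smul (-1)
  simp only [neg_one_smul, neg_neg] at h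
  rw [refl_weakDeriv (sobolev_anti one_le_two hU), h.weakDeriv_eq]

theorem refl_conjOp (hσ : MemLp σ ∞ (volume : Measure ℝ)) (hσ' : ∀ x, σ (-x) = σ x) {U : L2}
    (hU : U ∈ sobolev 2) : refl (conjOp c σ q U) = conjOp c σ q (refl U) := by
  have potential_neg (x : ℝ) : potential q (-x) = potential q x := by simp [potential]
  have hpot := (bddSmooth_potential q).memLp_top
  simp only [conjOp, lowerOrder, map_add, map_sub, map_smul]
  rw [refl_weakDeriv_weakDeriv hU, refl_mulL hpot hpot potential_neg,
    refl_mulL_of_odd bddSmooth_tanh.memLp_top fun x => by simp,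
    refl_weakDeriv (sobolev_anti one_le_two hU), refl_diffOp, refl_mulL hσ hσ hσ']

theorem conjOp_mem_evenL2 (hσ : MemLp σ ∞ (volume : Measure ℝ)) (hσ' : ∀ x, σ (-x) = σ x) {U : L2}
    (hU : U ∈ sobolev 2) (he : U ∈ evenL2) : conjOp c σ q U ∈ evenL2 := by
  rw [mem_evenL2_iff] at he ⊢
  rw [refl_conjOp hσ hσ' hU, he]

theorem lowerOrder_add {U V : L2} (hU : U ∈ sobolev 1) (hV : V ∈ sobolev 1) :
    lowerOrder c σ q (U + V) = lowerOrder c σ q U + lowerOrder c σ q V := by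
  simp only [lowerOrder, weakDeriv_add hU hV, map_add]
  module

theorem lowerOrder_smul (a : ℂ) {U : L2} (hU : U ∈ sobolev 1) :
    lowerOrder c σ q (a • U) = a • lowerOrder c σ q U := by
  simp only [lowerOrder, weakDeriv_smul a hU, map_smul]
  module

theorem conjOp_add {U V : L2} (hU : U ∈ sobolev 2) (hV : V ∈ sobolev 2) :
    conjOp c σ q (U + V) = conjOp c σ q U + conjOp c σ q V := by
  have hU' := sobolev_anti one_le_two hU
  have hV' := sobolev_anti one_le_two hV
  rw [conjOp, lowerOrder_add hU' hV', weakDeriv_add hU' hV',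
    weakDeriv_add (weakDeriv_mem_sobolev_one hU) (weakDeriv_mem_sobolev_one hV), conjOp, conjOp]
  module

theorem conjOp_smul (a : ℂ) {U : L2} (hU : U ∈ sobolev 2) :
    conjOp c σ q (a • U) = a • conjOp c σ q U := by
  have hU' := sobolev_anti one_le_two hU
  rw [conjOp, lowerOrder_smul a hU', weakDeriv_smul a hU',
    weakDeriv_smul a (weakDeriv_mem_sobolev_one hU), conjOp]
  module

theorem mulL_mem_sobolev_two {m : ℝ → ℂ} (hm : BddSmooth m) {f : L2} (hf : f ∈ sobolev 2) :
    mulL m f ∈ sobolev 2 := by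
  obtain ⟨C, hC⟩ := SobolevBdd.mulL hm 2
  exact (hC f hf).1

theorem weakDeriv_weakDeriv_mulL {m m' m'' : ℝ → ℂ} (hm : BddSmooth m)
    (hd : ∀ x, HasDerivAt m (m' x) x) (hd' : ∀ x, HasDerivAt m' (m'' x) x) {f : L2}
    (hf : f ∈ sobolev 2) : weakDeriv (weakDeriv (mulL m f)) =
      mulL m (weakDeriv (weakDeriv f)) + (2 : ℂ) • mulL m' (weakDeriv f) + mulL m'' f := by
  have hf' := sobolev_anti one_le_two hf
  have hm' := hm.of_hasDerivAt hd
  have hf₁ := weakDeriv_mem_sobolev_one hf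
  rw [weakDeriv_mulL hm hd hf',
    weakDeriv_add (mulL_mem_sobolev_one hm hf₁) (mulL_mem_sobolev_one hm' hf'),
    weakDeriv_mulL hm hd hf₁, weakDeriv_mulL hm' hd' hf']
  module

theorem mulL_mul_left {m k : ℝ → ℂ} (hm : MemLp m ∞ (volume : Measure ℝ))
    (hk : MemLp k ∞ (volume : Measure ℝ)) (f : L2) :
    mulL (fun x => m x * k x) f = mulL k (mulL m f) := by
  refine mulL_eq_of_ae (hk.mul hm) ?_
  filter_upwards [mulL_ae hk (mulL m f), mulL_ae hm f] with x hx hf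
  rw [hx, hf, Pi.mul_apply]
  ring

theorem mulL_const_mul {m : ℝ → ℂ} (hm : MemLp m ∞ (volume : Measure ℝ)) (a : ℂ) (f : L2) :
    mulL (fun x => a * m x) f = a • mulL m f := by
  refine mulL_eq_of_ae (hm.const_mul a) ?_
  filter_upwards [mulL_ae hm f, Lp.coeFn_smul a (mulL m f)] with x hx hsmul
  rw [hsmul, Pi.smul_apply, hx, smul_eq_mul, mul_assoc]

theorem hasDerivAt_coshPow_neg (q x : ℝ) :
    HasDerivAt (coshPow (-q)) (-q * ((Real.tanh x : ℂ) * coshPow (-q) x)) x :=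
  (hasDerivAt_coshPow (-q) x).congr_deriv (by push_cast; ring)

theorem weakDeriv_mulL_coshPow_neg (hq : 0 ≤ q) {U : L2} (hU : U ∈ sobolev 1) :
    weakDeriv (mulL (coshPow (-q)) U) =
      mulL (coshPow (-q)) (weakDeriv U - (q : ℂ) • mulL (fun x => (Real.tanh x : ℂ)) U) := by
  have hw := bddSmooth_coshPow_neg hq
  rw [weakDeriv_mulL hw (hasDerivAt_coshPow_neg q) hU,
    mulL_const_mul (bddSmooth_tanh.mul hw).memLp_top,
    mulL_mul_left bddSmooth_tanh.memLp_top hw.memLp_top, map_sub, map_smul]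
  module

theorem weakDeriv_weakDeriv_mulL_coshPow_neg (hq : 0 ≤ q) {U : L2} (hU : U ∈ sobolev 2) :
    weakDeriv (weakDeriv (mulL (coshPow (-q)) U)) =
      mulL (coshPow (-q)) (weakDeriv (weakDeriv U) + (mulL (potential q) U -
        (2 * q : ℂ) • mulL (fun x => (Real.tanh x : ℂ)) (weakDeriv U))) := by
  have hw := bddSmooth_coshPow_neg hq
  have hd' (x : ℝ) : HasDerivAt (fun x => -q * ((Real.tanh x : ℂ) * coshPow (-q) x))
      (potential q x * coshPow (-q) x) x :=
    (((hasDerivAt_tanh x).mul (hasDerivAt_coshPow_neg q x)).const_mul (-q : ℂ)).congr_deriv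
      (by rw [potential]; ring)
  rw [weakDeriv_weakDeriv_mulL hw (hasDerivAt_coshPow_neg q) hd' hU,
    mulL_const_mul (bddSmooth_tanh.mul hw).memLp_top, mulL_mul_left bddSmooth_tanh.memLp_top
    hw.memLp_top, mulL_mul_left (bddSmooth_potential q).memLp_top hw.memLp_top, map_add, map_sub,
    map_smul]
  module

theorem mulL_coshPow_neg_conjOp (hσ : MemLp σ ∞ (volume : Measure ℝ)) (hq : 0 ≤ q) {U : L2}
    (hU : U ∈ sobolev 2) :
    mulL (coshPow (-q)) (conjOp c σ q U) =ᵐ[volume] fun x =>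
      (c : ℂ) ^ 2 * weakDeriv (weakDeriv (mulL (coshPow (-q)) U)) x +
        twoSubA (fun y => σ y * mulL (coshPow (-q)) U y) x := by
  have hw := (bddSmooth_coshPow_neg hq).memLp_top
  have split : mulL (coshPow (-q)) (conjOp c σ q U) =
      (c : ℂ) ^ 2 • weakDeriv (weakDeriv (mulL (coshPow (-q)) U)) +
        mulL (coshPow (-q)) (diffOp q (mulL σ U)) := by
    rw [weakDeriv_weakDeriv_mulL_coshPow_neg hq hU, conjOp, lowerOrder, map_add, map_add, map_add,
      map_smul, map_smul, smul_add, add_assoc]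
  have swap : mulL (coshPow (-q)) (mulL σ U) =ᵐ[volume] fun x => σ x * mulL (coshPow (-q)) U x := by
    filter_upwards [mulL_ae hw (mulL σ U), mulL_ae hσ U, mulL_ae hw U] with x h hσ h0
    rw [h, hσ, h0]
    ring
  rw [split]
  filter_upwards [Lp.coeFn_add ((c : ℂ) ^ 2 • weakDeriv (weakDeriv (mulL (coshPow (-q)) U)))
      (mulL (coshPow (-q)) (diffOp q (mulL σ U))),
    Lp.coeFn_smul ((c : ℂ) ^ 2) (weakDeriv (weakDeriv (mulL (coshPow (-q)) U))),
    mulL_coshPow_neg_diffOp hq (mulL σ U), swap, ae_add_const 1 swap, ae_add_const (-1) swap]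
    with x hadd hsmul hdiff h0 hpos hneg
  rw [hadd, Pi.add_apply, hsmul, Pi.smul_apply, smul_eq_mul, hdiff]
  simp only [twoSubA, sub_eq_add_neg x 1, h0, hpos, hneg]

end

/-! ### Elliptic regularity -/

section

/-- Elliptic regularity for `conjOp c σ q`: an `H²` function whose image is in `H^r` belongs to
`H^{r + 2}`, with the corresponding estimate. -/
def EllipticEstimate (c : ℝ) (σ : ℝ → ℂ) (q r : ℝ) : Prop :=
  ∃ C : ℝ≥0, ∀ U ∈ sobolev 2, conjOp c σ q U ∈ sobolev r →
    U ∈ sobolev (r + 2) ∧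
      sobolevENorm (r + 2) U ≤ C * (sobolevENorm 2 U + sobolevENorm r (conjOp c σ q U))

variable {c : ℝ} {σ : ℝ → ℂ} {q r : ℝ}

theorem sobolevBdd_diffOp (q : ℝ) (n : ℕ) : SobolevBdd n n (diffOp q) :=
  ((SobolevBdd.id le_rfl).smul 2).sub
    (((SobolevBdd.mulL (bddSmooth_weightRatio q 1) n).comp (.shift 1 n)).add
      ((SobolevBdd.mulL (bddSmooth_weightRatio q (-1)) n).comp (.shift (-1) n)))

theorem sobolevBdd_lowerOrder (hσ : BddSmooth σ) (n : ℕ) :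
    SobolevBdd (n + 1) n (lowerOrder c σ q) := by
  have incl : SobolevBdd (n + 1) n fun U => U := .id (by linarith)
  have potential := (SobolevBdd.mulL (bddSmooth_potential q) n).comp incl
  have drift := (SobolevBdd.mulL bddSmooth_tanh n).comp (.weakDeriv n.cast_nonneg)
  have nonlocal := (sobolevBdd_diffOp q n).comp ((SobolevBdd.mulL hσ n).comp incl)
  exact ((potential.sub (drift.smul _)).smul _).add nonlocal

theorem sobolevBdd_conjOp (hσ : BddSmooth σ) (hr : 0 ≤ r) :
    SobolevBdd (r + 2) r (conjOp c σ q) := by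
  have lower : SobolevBdd (r + 2) r (lowerOrder c σ q) :=
    (SobolevBdd.id (Nat.le_ceil r)).comp ((sobolevBdd_lowerOrder hσ ⌈r⌉₊).comp
      (.id (by linarith [Nat.ceil_lt_add_one hr])))
  have second : SobolevBdd (r + 2) r fun U => weakDeriv (weakDeriv U) :=
    (SobolevBdd.weakDeriv hr).comp
      ((SobolevBdd.weakDeriv (by positivity)).comp (.id (by linarith)))
  exact (second.smul _).add lower

theorem mem_sobolev_add_two (hr : 0 ≤ r) {U : L2} (hU : U ∈ sobolev (r + 1)) (hU₂ : U ∈ sobolev 2)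
    (h : weakDeriv (weakDeriv U) ∈ sobolev r) :
    U ∈ sobolev (r + 2) ∧ sobolevENorm (r + 2) U ≤
      2 * sobolevENorm (r + 1) U + sobolevENorm r (weakDeriv (weakDeriv U)) := by
  have d₁ := hasWeakDeriv_weakDeriv (sobolev_anti one_le_two hU₂)
  have d₂ := hasWeakDeriv_weakDeriv (weakDeriv_mem_sobolev_one hU₂)
  rw [show r + 2 = r + 1 + 1 by ring]
  refine ⟨d₁.mem_sobolev_succ (by positivity) hU
    (d₂.mem_sobolev_succ hr (weakDeriv_mem_sobolev hr hU) h), ?_⟩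
  calc sobolevENorm (r + 1 + 1) U
      ≤ sobolevENorm (r + 1) U + sobolevENorm (r + 1) (weakDeriv U) := d₁.sobolevENorm_succ_le _
    _ ≤ sobolevENorm (r + 1) U +
        (sobolevENorm (r + 1) U + sobolevENorm r (weakDeriv (weakDeriv U))) := by
      gcongr
      exact (d₂.sobolevENorm_succ_le r).trans (by gcongr; exact d₁.sobolevENorm_le r)
    _ = _ := by rw [two_mul, add_assoc]

theorem weakDeriv_weakDeriv_eq (hc : c ≠ 0) (U : L2) :
    weakDeriv (weakDeriv U) =
      ((c : ℂ) ^ 2)⁻¹ • (conjOp c σ q U - lowerOrder c σ q U) := by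
  rw [conjOp, add_sub_cancel_right, inv_smul_smul₀ (pow_ne_zero 2 (Complex.ofReal_ne_zero.2 hc))]

theorem EllipticEstimate.of_nat (hc : c ≠ 0) (hσ : BddSmooth σ) {n : ℕ}
    (h : EllipticEstimate c σ q n) (hnr : n ≤ r) (hrn : r ≤ n + 1) : EllipticEstimate c σ q r := by
  obtain ⟨C, hC⟩ := h
  obtain ⟨K, hK⟩ : SobolevBdd (n + 2) r (lowerOrder c σ q) := by
    have lower := sobolevBdd_lowerOrder (c := c) (q := q) hσ (n + 1)
    push_cast at lower
    exact (SobolevBdd.id hrn).comp (lower.comp (.id (by linarith)))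
  set a := ‖((c : ℂ) ^ 2)⁻¹‖₊
  refine ⟨(2 + a * K) * C + a, fun U hU hG => ?_⟩
  set X := sobolevENorm 2 U
  set Y := sobolevENorm r (conjOp c σ q U)
  obtain ⟨hn, norm_le⟩ := hC U hU (sobolev_anti hnr hG)
  replace norm_le : sobolevENorm (n + 2) U ≤ C * (X + Y) :=
    norm_le.trans (by gcongr; exact sobolevENorm_mono hnr _)
  have second := weakDeriv_weakDeriv_eq (σ := σ) (q := q) hc U
  have second_mem : weakDeriv (weakDeriv U) ∈ sobolev r := by
    rw [second]
    exact Submodule.smul_mem _ _ (sub_mem hG (hK U hn).1)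
  have second_le : sobolevENorm r (weakDeriv (weakDeriv U)) ≤ a * (Y + K * (C * (X + Y))) := by
    rw [second, sobolevENorm_smul]
    change (a : ℝ≥0∞) * _ ≤ _
    gcongr
    refine (sobolevENorm_sub_le _ _ _).trans (add_le_add le_rfl ((hK U hn).2.trans ?_))
    gcongr
  obtain ⟨mem, le⟩ := mem_sobolev_add_two (n.cast_nonneg.trans hnr)
    (sobolev_anti (by linarith) hn) hU second_mem
  refine ⟨mem, le.trans ?_⟩
  calc 2 * sobolevENorm (r + 1) U + sobolevENorm r (weakDeriv (weakDeriv U))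
      ≤ 2 * (C * (X + Y)) + a * (Y + K * (C * (X + Y))) := by
        gcongr
        exact (sobolevENorm_mono (by linarith) U).trans norm_le
    _ ≤ 2 * (C * (X + Y)) + a * (Y + K * (C * (X + Y))) + a * X := le_self_add
    _ = ((2 + a * K) * C + a : ℝ≥0) * (X + Y) := by push_cast; ring

theorem ellipticEstimate (hc : c ≠ 0) (hσ : BddSmooth σ) (q : ℝ) (hr : 0 ≤ r) :
    EllipticEstimate c σ q r := by
  have nat (n : ℕ) : EllipticEstimate c σ q n := by
    induction n with
    | zero => exact ⟨1, fun U hU _ => by simpa using hU⟩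
    | succ n ih => exact ih.of_nat hc hσ (by simp) (by simp)
  exact (nat ⌊r⌋₊).of_nat hc hσ (Nat.floor_le hr) (Nat.lt_floor_add_one r).le

end

/-! ### Continuity in the weight -/

/-- A bound for `conjOp c σ q - conjOp c σ p` as an operator from `H²` to `L²` when `‖σ‖ ≤ M`; the
principal parts cancel, so that it vanishes at `q = p`. -/
def conjOpModulus (c M p q : ℝ) : ℝ :=
  c ^ 2 * (|q * (q + 1) - p * (p + 1)| + 3 * |q - p|) +
    2 * (Real.exp |p| * (Real.exp |q - p| - 1) * M)

theorem norm_potential_sub_le (p q x : ℝ) :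
    ‖potential q x - potential p x‖ ≤ |q * (q + 1) - p * (p + 1)| + |q - p| := by
  have h : potential q x - potential p x =
      (((q * (q + 1) - p * (p + 1)) * Real.tanh x ^ 2 - (q - p) : ℝ) : ℂ) := by
    simp only [potential]
    push_cast
    ring
  rw [h, Complex.norm_real]
  refine (norm_sub_le _ _).trans (add_le_add ?_ le_rfl)
  rw [norm_mul, Real.norm_of_nonneg (sq_nonneg (Real.tanh x))]
  exact mul_le_of_le_one_right (norm_nonneg _) (Real.tanh_sq_lt_one x).le

theorem conjOp_sub_conjOp (c : ℝ) (σ : ℝ → ℂ) (p q : ℝ) (U : L2) :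
    conjOp c σ q U - conjOp c σ p U =
      (c : ℂ) ^ 2 • (mulL (fun x => potential q x - potential p x) U -
        (2 * (q - p : ℝ) : ℂ) • mulL (fun x => (Real.tanh x : ℂ)) (weakDeriv U)) -
      (mulL (fun x => weightRatio q 1 x - weightRatio p 1 x) (shift 1 (mulL σ U)) +
        mulL (fun x => weightRatio q (-1) x - weightRatio p (-1) x) (shift (-1) (mulL σ U))) := by
  have hr (q a : ℝ) := (bddSmooth_weightRatio q a).memLp_top
  rw [mulL_sub_left (bddSmooth_potential q).memLp_top (bddSmooth_potential p).memLp_top,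
    mulL_sub_left (hr q 1) (hr p 1), mulL_sub_left (hr q (-1)) (hr p (-1))]
  simp only [conjOp, lowerOrder, diffOp_apply]
  push_cast
  module

theorem norm_mulL_weightRatio_sub_le {σ : ℝ → ℂ} (hσ : MemLp σ ∞ (volume : Measure ℝ)) {M : ℝ}
    (hM : ∀ x, ‖σ x‖ ≤ M) (p q : ℝ) {a : ℝ} (ha : |a| = 1) (U : L2) :
    ‖mulL (fun x => weightRatio q a x - weightRatio p a x) (shift a (mulL σ U))‖ ≤
      Real.exp |p| * (Real.exp |q - p| - 1) * M * ‖U‖ := by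
  have ratio_le (x : ℝ) := norm_weightRatio_sub_weightRatio_le p q a x
  simp only [ha, mul_one] at ratio_le
  calc _ ≤ Real.exp |p| * (Real.exp |q - p| - 1) * ‖shift a (mulL σ U)‖ :=
        norm_mulL_le ((bddSmooth_weightRatio q a).sub (bddSmooth_weightRatio p a)).memLp_top
          ratio_le _
    _ ≤ Real.exp |p| * (Real.exp |q - p| - 1) * (M * ‖U‖) := by
        rw [LinearIsometry.norm_map]
        gcongr
        · exact (norm_nonneg _).trans (ratio_le 0)
        · exact norm_mulL_le hσ hM U
    _ = _ := by ring

theorem norm_conjOp_sub_le {σ : ℝ → ℂ} (hσ : MemLp σ ∞ (volume : Measure ℝ)) {M : ℝ}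
    (hM : ∀ x, ‖σ x‖ ≤ M) (c p q : ℝ) {U : L2} {N : ℝ} (hU : ‖U‖ ≤ N) (hU' : ‖weakDeriv U‖ ≤ N) :
    ‖conjOp c σ q U - conjOp c σ p U‖ ≤ conjOpModulus c M p q * N := by
  have hM₀ : 0 ≤ M := (norm_nonneg _).trans (hM 0)
  have potential_le : ‖mulL (fun x => potential q x - potential p x) U‖ ≤
      (|q * (q + 1) - p * (p + 1)| + |q - p|) * N :=
    (norm_mulL_le ((bddSmooth_potential q).sub (bddSmooth_potential p)).memLp_top
      (norm_potential_sub_le p q) U).trans (by gcongr)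
  have drift_le : ‖(2 * (q - p : ℝ) : ℂ) • mulL (fun x => (Real.tanh x : ℂ)) (weakDeriv U)‖ ≤
      2 * |q - p| * N := by
    have tanh_le (x : ℝ) : ‖(Real.tanh x : ℂ)‖ ≤ 1 := by
      rw [Complex.norm_real]
      exact (Real.abs_tanh_lt_one x).le
    rw [norm_smul, norm_mul, Complex.norm_real, Complex.norm_ofNat, Real.norm_eq_abs]
    gcongr
    exact (norm_mulL_le bddSmooth_tanh.memLp_top tanh_le _).trans (by rwa [one_mul])
  have shift_le {a : ℝ} (ha : |a| = 1) :
      ‖mulL (fun x => weightRatio q a x - weightRatio p a x) (shift a (mulL σ U))‖ ≤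
        Real.exp |p| * (Real.exp |q - p| - 1) * M * N := by
    refine (norm_mulL_weightRatio_sub_le hσ hM p q ha U).trans ?_
    have : 0 ≤ Real.exp |q - p| - 1 := sub_nonneg.2 (Real.one_le_exp (abs_nonneg _))
    gcongr
  have norm_c : ‖(c : ℂ) ^ 2‖ = c ^ 2 := by
    rw [norm_pow, Complex.norm_real, Real.norm_eq_abs, sq_abs]
  rw [conjOp_sub_conjOp]
  refine (norm_sub_le_of_le ?_ (norm_add_le_of_le (shift_le abs_one)
    (shift_le (by rw [abs_neg, abs_one])))).trans_eq
    (?_ : c ^ 2 * ((|q * (q + 1) - p * (p + 1)| + |q - p|) * N + 2 * |q - p| * N) + _ = _)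
  · rw [norm_smul, norm_c]
    gcongr
    exact norm_sub_le_of_le potential_le drift_le
  · rw [conjOpModulus]
    ring

theorem eventually_conjOpModulus_lt (c M p : ℝ) {ε : ℝ} (hε : 0 < ε) :
    ∀ᶠ q in nhds p, conjOpModulus c M p q < ε := by
  have hcont : Continuous (conjOpModulus c M p) := by
    unfold conjOpModulus
    fun_prop
  have hp : conjOpModulus c M p p = 0 := by simp [conjOpModulus]
  exact hcont.continuousAt.eventually_lt_const (hp.trans_lt hε)

theorem norm_le_toReal_sobolevENorm_two {U : L2} (hU : U ∈ sobolev 2) :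
    ‖U‖ ≤ (sobolevENorm 2 U).toReal ∧ ‖weakDeriv U‖ ≤ (sobolevENorm 2 U).toReal := by
  have hfin : sobolevENorm 2 U ≠ ∞ := ((mem_sobolev_iff zero_le_two U).1 hU).ne
  have h₀ : ‖U‖ₑ ≤ sobolevENorm 2 U := enorm_le_sobolevENorm zero_le_two U
  have h₁ : ‖weakDeriv U‖ₑ ≤ sobolevENorm 2 U :=
    calc ‖weakDeriv U‖ₑ ≤ sobolevENorm 0 (weakDeriv U) := enorm_le_sobolevENorm le_rfl _
      _ ≤ sobolevENorm (0 + 1) U := sobolevENorm_weakDeriv_le 0 (sobolev_anti one_le_two hU)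
      _ ≤ sobolevENorm 2 U := sobolevENorm_mono (by norm_num) U
  rw [← toReal_enorm, ← toReal_enorm]
  exact ⟨ENNReal.toReal_mono hfin h₀, ENNReal.toReal_mono hfin h₁⟩

/-! ### The solvability condition -/

section

variable {c : ℝ} {σ : ℝ → ℂ} {q : ℝ}

/-- The weight `cosh^{-q}` as an element of `L²`. -/
def weightInv (hq : 0 < q) : L2 := (memLp_coshPow_neg hq).toLp (coshPow (-q))

/-- The even functions `G` for which `cosh^{-q} G` has mean zero. For `q > 0` these are the even
functions orthogonal to `cosh^{-q}`, and the conjugate by `cosh^q` of the space `E₀ 0 q`. -/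
def evenPerp (q : ℝ) : Submodule ℂ L2 :=
  evenL2 ⊓ meanZeroL2.comap (mulL (coshPow (-q))).toLinearMap

theorem integrable_mulL_coshPow_neg (hq : 0 < q) (U : L2) :
    Integrable (mulL (coshPow (-q)) U) (volume : Measure ℝ) :=
  ((memLp_coshPow_neg hq).integrable_mul (Lp.memLp U)).congr
    (mulL_ae (bddSmooth_coshPow_neg hq.le).memLp_top U).symm

theorem inner_weightInv (hq : 0 < q) (G : L2) :
    inner ℂ (weightInv hq) G = ∫ x, mulL (coshPow (-q)) G x := by
  rw [L2.inner_def]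
  refine integral_congr_ae ?_
  filter_upwards [(memLp_coshPow_neg hq).coeFn_toLp,
    mulL_ae (bddSmooth_coshPow_neg hq.le).memLp_top G] with x hw hx
  rw [weightInv, hw, hx, RCLike.inner_apply, coshPow, Complex.conj_ofReal, mul_comm]

theorem mem_evenPerp_iff (hq : 0 < q) {G : L2} :
    G ∈ evenPerp q ↔ G ∈ evenL2 ∧ inner ℂ (weightInv hq) G = 0 := by
  rw [inner_weightInv]
  exact and_congr_right fun _ => and_iff_right (integrable_mulL_coshPow_neg hq G)

theorem weightInv_mem_evenL2 (hq : 0 < q) : weightInv hq ∈ evenL2 := by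
  have h : weightInv hq =ᵐ[volume] coshPow (-q) := (memLp_coshPow_neg hq).coeFn_toLp
  change ∀ᵐ x : ℝ, weightInv hq (-x) = weightInv hq x
  filter_upwards [h, ae_neg h] with x hx hneg
  rw [hx, hneg, coshPow_neg_right]

theorem inner_weightInv_weightInv_ne_zero {p : ℝ} (hp : 0 < p) (hq : 0 < q) :
    inner ℂ (weightInv hp) (weightInv hq) ≠ 0 := by
  have h : inner ℂ (weightInv hp) (weightInv hq) =
      ((∫ x : ℝ, Real.cosh x ^ (-(p + q)) : ℝ) : ℂ) := by
    rw [inner_weightInv hp, ← integral_complex_ofReal]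
    refine integral_congr_ae ?_
    filter_upwards [(memLp_coshPow_neg hq).coeFn_toLp,
      mulL_ae (bddSmooth_coshPow_neg hp.le).memLp_top (weightInv hq)] with x hw hx
    rw [hx, weightInv, hw, ← coshPow_add, ← neg_add, coshPow]
  have cosh_integrable : Integrable fun x => Real.cosh x ^ (-(p + q)) :=
    (integrable_coshPow_neg (add_pos hp hq)).norm.congr
      (Eventually.of_forall fun x => norm_coshPow _ x)
  have hpos (x : ℝ) : 0 < Real.cosh x ^ (-(p + q)) := Real.rpow_pos_of_pos (Real.cosh_pos x) _
  have support : Function.support (fun x => Real.cosh x ^ (-(p + q))) = Set.univ :=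
    Set.eq_univ_of_forall fun x => (hpos x).ne'
  rw [h, Complex.ofReal_ne_zero]
  refine ((integral_pos_iff_support_of_nonneg (fun x => (hpos x).le) cosh_integrable).2 ?_).ne'
  simp only [support, Real.volume_univ, ENNReal.zero_lt_top]

theorem integral_weakDeriv_weakDeriv_mulL_coshPow_neg (hq : 0 < q) {U : L2} (hU : U ∈ sobolev 2) :
    ∫ x, weakDeriv (weakDeriv (mulL (coshPow (-q)) U)) x = 0 := by
  have hw := bddSmooth_coshPow_neg hq.le
  have first : Integrable (weakDeriv (mulL (coshPow (-q)) U)) volume := by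
    rw [weakDeriv_mulL_coshPow_neg hq.le (sobolev_anti one_le_two hU)]
    exact integrable_mulL_coshPow_neg hq _
  have second : Integrable (weakDeriv (weakDeriv (mulL (coshPow (-q)) U))) volume := by
    rw [weakDeriv_weakDeriv_mulL_coshPow_neg hq.le hU]
    exact integrable_mulL_coshPow_neg hq _
  exact (hasWeakDeriv_weakDeriv (weakDeriv_mem_sobolev_one (mulL_mem_sobolev_two hw hU)))
    |>.integral_eq_zero first second

theorem integrable_twoSubA {g : ℝ → ℂ} (hg : Integrable g volume) :
    Integrable (twoSubA g) volume :=
  (hg.const_mul 2).sub ((hg.comp_add_right 1).add (hg.comp_sub_right 1))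

theorem integral_twoSubA {g : ℝ → ℂ} (hg : Integrable g volume) : ∫ x, twoSubA g x = 0 := by
  have hpos := hg.comp_add_right 1
  have hneg := hg.comp_sub_right 1
  simp only [twoSubA]
  rw [integral_sub (hg.const_mul 2) (by exact hpos.add hneg), integral_add hpos hneg,
    integral_add_right_eq_self g, integral_sub_right_eq_self g, integral_const_mul]
  ring

theorem conjOp_mem_evenPerp (hσ : MemLp σ ∞ (volume : Measure ℝ)) (hσ' : ∀ x, σ (-x) = σ x)
    (hq : 0 < q) {U : L2} (hU : U ∈ sobolev 2) (he : U ∈ evenL2) :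
    conjOp c σ q U ∈ evenPerp q := by
  have second : Integrable (weakDeriv (weakDeriv (mulL (coshPow (-q)) U))) volume := by
    rw [weakDeriv_weakDeriv_mulL_coshPow_neg hq.le hU]
    exact integrable_mulL_coshPow_neg hq _
  have nonlocal : Integrable (fun x => σ x * mulL (coshPow (-q)) U x) volume :=
    (integrable_mulL_coshPow_neg hq U).mul_of_top_right hσ
  refine (mem_evenPerp_iff hq).2 ⟨conjOp_mem_evenL2 hσ hσ' hU he, ?_⟩
  rw [inner_weightInv, integral_congr_ae (mulL_coshPow_neg_conjOp hσ hq.le hU),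
    integral_add (second.const_mul _) (integrable_twoSubA nonlocal), integral_const_mul,
    integral_weakDeriv_weakDeriv_mulL_coshPow_neg hq hU, integral_twoSubA nonlocal, mul_zero,
    add_zero]

end

/-! ### Openness of invertibility -/

theorem surjective_of_norm_sub_le {𝕜 E F : Type*} [NontriviallyNormedField 𝕜] [AddCommGroup E]
    [Module 𝕜 E] [NormedAddCommGroup F] [NormedSpace 𝕜 F] [CompleteSpace F] {S T : E →ₗ[𝕜] F}
    (hS : Function.Surjective S) {θ : ℝ} (hθ₀ : 0 ≤ θ) (hθ : θ < 1)
    (h : ∀ x, ‖S x - T x‖ ≤ θ * ‖S x‖) : Function.Surjective T := by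
  obtain ⟨R, hR⟩ := S.exists_rightInverse_of_surjective (LinearMap.range_eq_top.2 hS)
  have hSR (y : F) : S (R y) = y := LinearMap.congr_fun hR y
  let B : F →L[𝕜] F := ((S - T) ∘ₗ R).mkContinuous θ fun y => by simpa [hSR] using h (R y)
  obtain ⟨u, hu⟩ := isUnit_one_sub_of_norm_lt_one (x := B)
    ((LinearMap.mkContinuous_norm_le _ hθ₀ _).trans_lt hθ)
  intro y
  refine ⟨R ((↑u⁻¹ : F →L[𝕜] F) y), ?_⟩
  have hTR (z : F) : T (R z) = (1 - B) z := by simp [B, hSR]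
  rw [hTR, ← hu, ← mul_apply_eq_comp, Units.mul_inv, one_apply_eq_self]

section

variable {c : ℝ} {σ : ℝ → ℂ} {p q : ℝ}

theorem completeSpace_evenPerp (hq : 0 < q) : CompleteSpace (evenPerp q) := by
  have h : (evenPerp q : Set L2) = {G | refl G = G} ∩ {G | inner ℂ (weightInv hq) G = 0} := by
    ext G
    rw [SetLike.mem_coe, mem_evenPerp_iff hq, mem_evenL2_iff]
    rfl
  have hclosed : IsClosed (evenPerp q : Set L2) := by
    rw [h]
    exact (isClosed_eq refl.continuous continuous_id).inter
      (isClosed_eq (by fun_prop) continuous_const)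
  exact hclosed.completeSpace_coe

theorem eq_zero_of_mem_evenPerp_of_mem_orthogonal (hp : 0 < p) (hq : 0 < q) {G : L2}
    (hG : G ∈ evenPerp q) (hGp : G ∈ (evenPerp p)ᗮ) : G = 0 := by
  obtain ⟨he, hGq⟩ := (mem_evenPerp_iff hq).1 hG
  have hw := inner_weightInv_weightInv_ne_zero hp hp
  set a := inner ℂ (weightInv hp) G / inner ℂ (weightInv hp) (weightInv hp)
  have residual_mem : G - a • weightInv hp ∈ evenPerp p := by
    refine (mem_evenPerp_iff hp).2
      ⟨sub_mem he (Submodule.smul_mem _ _ (weightInv_mem_evenL2 hp)), ?_⟩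
    rw [inner_sub_right, inner_smul_right, div_mul_cancel₀ _ hw, sub_self]
  have residual_perp : G - a • weightInv hp ∈ (evenPerp p)ᗮ := by
    refine sub_mem hGp (Submodule.smul_mem _ _ fun K hK => ?_)
    exact inner_eq_zero_symm.1 ((mem_evenPerp_iff hp).1 hK).2
  have hG_eq : G = a • weightInv hp :=
    sub_eq_zero.1 (inner_self_eq_zero.1 (residual_perp _ residual_mem))
  rw [hG_eq, inner_smul_right] at hGq
  rw [hG_eq, (mul_eq_zero.1 hGq).resolve_right (inner_weightInv_weightInv_ne_zero hq hp), zero_smul]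

/-- The conjugated operator is invertible from the even functions in `H²` onto the even functions
orthogonal to `cosh^{-q}`; the converse inclusion for the range is `conjOp_mem_evenPerp`. -/
structure IsEvenIso (c : ℝ) (σ : ℝ → ℂ) (q : ℝ) : Prop where
  exists_le : ∃ C : ℝ≥0, ∀ U ∈ sobolev 2 ⊓ evenL2, sobolevENorm 2 U ≤ C * ‖conjOp c σ q U‖ₑ
  exists_eq : ∀ G ∈ evenPerp q, ∃ U ∈ sobolev 2 ⊓ evenL2, conjOp c σ q U = G

/-- The conjugated operator from the even functions in `H²` to its natural range. -/
def conjMap (hσ : MemLp σ ∞ (volume : Measure ℝ)) (hσ' : ∀ x, σ (-x) = σ x) (c : ℝ) (hq : 0 < q) :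
    (sobolev 2 ⊓ evenL2 : Submodule ℂ L2) →ₗ[ℂ] evenPerp q where
  toFun U := ⟨conjOp c σ q U, conjOp_mem_evenPerp hσ hσ' hq U.2.1 U.2.2⟩
  map_add' U V := Subtype.ext (conjOp_add U.2.1 V.2.1)
  map_smul' a U := Subtype.ext (conjOp_smul a U.2.1)

theorem IsEvenIso.eventually_norm_conjOp_sub_le (h : IsEvenIso c σ p)
    (hσ : BddSmooth σ) {θ : ℝ} (hθ : 0 < θ) : ∀ᶠ q in nhds p, ∀ U ∈ sobolev 2 ⊓ evenL2,
      ‖conjOp c σ q U - conjOp c σ p U‖ ≤ θ * ‖conjOp c σ p U‖ := by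
  obtain ⟨C, hC⟩ := h.exists_le
  obtain ⟨M, hM⟩ := hσ.bdd
  have C_pos : (0 : ℝ) < C + 1 := by positivity
  filter_upwards [eventually_conjOpModulus_lt c M p (div_pos hθ C_pos)] with q hq U hU
  obtain ⟨hUN, hU'N⟩ := norm_le_toReal_sobolevENorm_two hU.1
  have hN : (sobolevENorm 2 U).toReal ≤ C * ‖conjOp c σ p U‖ := by
    simpa using ENNReal.toReal_mono (ENNReal.mul_ne_top ENNReal.coe_ne_top enorm_ne_top) (hC U hU)
  calc ‖conjOp c σ q U - conjOp c σ p U‖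
      ≤ conjOpModulus c M p q * (sobolevENorm 2 U).toReal :=
        norm_conjOp_sub_le hσ.memLp_top hM c p q hUN hU'N
    _ ≤ θ / (C + 1) * ((C + 1) * ‖conjOp c σ p U‖) := by
        gcongr
        linarith [norm_nonneg (conjOp c σ p U)]
    _ = θ * ‖conjOp c σ p U‖ := by field_simp

theorem IsEvenIso.exists_conjOp_eq (h : IsEvenIso c σ p) (hσ : MemLp σ ∞ (volume : Measure ℝ))
    (hσ' : ∀ x, σ (-x) = σ x) (hp : 0 < p) (hq : 0 < q) {θ : ℝ} (hθ₀ : 0 ≤ θ)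
    (hθ : θ < 1) (hnear : ∀ U ∈ sobolev 2 ⊓ evenL2,
      ‖conjOp c σ q U - conjOp c σ p U‖ ≤ θ * ‖conjOp c σ p U‖) {G : L2} (hG : G ∈ evenPerp q) :
    ∃ U ∈ sobolev 2 ⊓ evenL2, conjOp c σ q U = G := by
  have := completeSpace_evenPerp hp
  let P := (evenPerp p).orthogonalProjectionOnto
  let T := P.toLinearMap ∘ₗ (evenPerp q).subtype ∘ₗ conjMap hσ hσ' c hq
  have hS : Function.Surjective (conjMap hσ hσ' c hp) := fun K => by
    obtain ⟨U, hU, hUK⟩ := h.exists_eq K K.2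
    exact ⟨⟨U, hU⟩, Subtype.ext hUK⟩
  have hT : Function.Surjective T := by
    refine surjective_of_norm_sub_le hS hθ₀ hθ fun U => ?_
    have e : conjMap hσ hσ' c hp U - T U = P (conjOp c σ p U - conjOp c σ q U) := by
      rw [map_sub]
      congr 1
      exact ((evenPerp p).orthogonalProjectionOnto_mem_subspace_eq_self
        (conjMap hσ hσ' c hp U)).symm
    rw [e]
    refine ((evenPerp p).norm_orthogonalProjectionOnto_apply_le _).trans ?_
    rw [norm_sub_rev]
    exact hnear U U.2
  obtain ⟨U, hU⟩ := hT (P G)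
  refine ⟨U, U.2, sub_eq_zero.1 (eq_zero_of_mem_evenPerp_of_mem_orthogonal hp hq
    (sub_mem (conjMap hσ hσ' c hq U).2 hG) ?_)⟩
  rw [← Submodule.orthogonalProjectionOnto_eq_zero_iff, map_sub, sub_eq_zero]
  exact hU

theorem IsEvenIso.eventually (h : IsEvenIso c σ p) (hσ : BddSmooth σ) (hσ' : ∀ x, σ (-x) = σ x)
    (hp : 0 < p) : ∀ᶠ q in nhds p, IsEvenIso c σ q := by
  filter_upwards [h.eventually_norm_conjOp_sub_le hσ one_half_pos, eventually_gt_nhds hp]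
    with q hnear hq
  obtain ⟨C, hC⟩ := h.exists_le
  refine ⟨⟨C * 2, fun U hU => (hC U hU).trans ?_⟩,
    fun G hG => h.exists_conjOp_eq hσ.memLp_top hσ' hp hq one_half_pos.le one_half_lt_one hnear hG⟩
  have le_two_mul : ‖conjOp c σ p U‖ ≤ 2 * ‖conjOp c σ q U‖ := by
    have := norm_le_norm_add_norm_sub (conjOp c σ q U) (conjOp c σ p U)
    linarith [hnear U hU]
  rw [ENNReal.coe_mul, mul_assoc]
  gcongr
  rw [enorm_eq_nnnorm, enorm_eq_nnnorm]
  exact_mod_cast le_two_mul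

end

/-! ### Transfer to the weighted spaces -/

section

variable {c : ℝ} {σ : ℝ → ℂ} {ς : L2} {r q : ℝ}

theorem ae_eq_coshMul_iff (hq : 0 ≤ q) {f U : L2} :
    U =ᵐ[volume] coshMul q f ↔ mulL (coshPow (-q)) U = f := by
  have hm := (bddSmooth_coshPow_neg hq).memLp_top
  constructor
  · intro h
    refine mulL_eq_of_ae hm (h.mono fun x hx => ?_)
    change f x = coshPow (-q) x * U x
    rw [show U x = coshPow q x * f x from hx, ← mul_assoc, mul_comm (coshPow (-q) x),
      coshPow_mul_coshPow_neg, one_mul]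
  · rintro rfl
    filter_upwards [mulL_ae hm U] with x hx
    change U x = coshPow q x * mulL (coshPow (-q)) U x
    rw [hx, ← mul_assoc, coshPow_mul_coshPow_neg, one_mul]

theorem mulL_coshPow_neg_injective (hq : 0 ≤ q) : Function.Injective (mulL (coshPow (-q))) :=
  fun _ _ h => Lp.ext <| ((ae_eq_coshMul_iff hq).2 rfl).trans ((ae_eq_coshMul_iff hq).2 h.symm).symm

theorem weightedENorm_mulL_coshPow_neg (hq : 0 ≤ q) (r : ℝ) (U : L2) :
    weightedENorm r q (mulL (coshPow (-q)) U) = sobolevENorm r U := by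
  refine le_antisymm (iInf₂_le U ((ae_eq_coshMul_iff hq).2 rfl)) (le_iInf₂ fun V hV => ?_)
  rw [mulL_coshPow_neg_injective hq ((ae_eq_coshMul_iff hq).1 hV)]

theorem mulL_coshPow_neg_mem_evenL2_iff (hq : 0 ≤ q) {U : L2} :
    mulL (coshPow (-q)) U ∈ evenL2 ↔ U ∈ evenL2 := by
  have hU := mulL_ae (bddSmooth_coshPow_neg hq).memLp_top U
  change (∀ᵐ x : ℝ, mulL (coshPow (-q)) U (-x) = mulL (coshPow (-q)) U x) ↔ ∀ᵐ x : ℝ, U (-x) = U x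
  refine Filter.eventually_congr ?_
  filter_upwards [hU, ae_neg hU] with x hx hx'
  rw [hx, hx', coshPow_neg_right]
  exact mul_right_inj' (coshPow_ne_zero (-q) x)

theorem mem_E_iff (hq : 0 ≤ q) {f : L2} :
    f ∈ E r q ↔ f ∈ sobolev r ∧ ∃ U ∈ sobolev r ⊓ evenL2, mulL (coshPow (-q)) U = f := by
  constructor
  · rintro ⟨⟨hf, U, hU, hUf⟩, he⟩
    obtain rfl := (ae_eq_coshMul_iff hq).1 hUf
    exact ⟨hf, U, ⟨hU, (mulL_coshPow_neg_mem_evenL2_iff hq).1 he⟩, rfl⟩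
  · rintro ⟨hf, U, ⟨hU, he⟩, rfl⟩
    exact ⟨⟨hf, U, hU, (ae_eq_coshMul_iff hq).2 rfl⟩, (mulL_coshPow_neg_mem_evenL2_iff hq).2 he⟩

theorem mem_E₀_iff (hq : 0 ≤ q) {f : L2} :
    f ∈ E₀ r q ↔ f ∈ sobolev r ∧ ∃ U ∈ sobolev r ⊓ evenPerp q, mulL (coshPow (-q)) U = f := by
  rw [E₀, Submodule.mem_inf, mem_E_iff hq]
  constructor
  · rintro ⟨⟨hf, U, ⟨hU, he⟩, rfl⟩, h0⟩
    exact ⟨hf, U, ⟨hU, he, h0⟩, rfl⟩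
  · rintro ⟨hf, U, ⟨hU, he, h0⟩, rfl⟩
    exact ⟨⟨hf, U, ⟨hU, he⟩, rfl⟩, h0⟩

theorem conjOp_zero_ae (hσ : MemLp σ ∞ (volume : Measure ℝ)) {f : L2} (hf : f ∈ sobolev 2) :
    conjOp c σ 0 f =ᵐ[volume] fun x =>
      (c : ℂ) ^ 2 * weakDeriv (weakDeriv f) x + twoSubA (fun y => σ y * f y) x := by
  have mulL_eq (g : L2) : mulL (coshPow (-0)) g = g := by
    refine mulL_eq_of_ae (bddSmooth_coshPow_neg le_rfl).memLp_top (.of_forall fun x => ?_)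
    simp [coshPow_zero]
  simpa only [mulL_eq] using mulL_coshPow_neg_conjOp (c := c) hσ le_rfl hf

theorem conjOp_zero_ae_linearization (hσ : MemLp σ ∞ (volume : Measure ℝ))
    (hς : σ =ᵐ[volume] fun x => 1 + 2 * ς x) {f : L2} (hf : f ∈ sobolev 2) :
    conjOp c σ 0 f =ᵐ[volume] linearization c ς f := by
  filter_upwards [conjOp_zero_ae (c := c) hσ hf, hς, ae_add_const 1 hς, ae_add_const (-1) hς]
    with x h h₀ h₁ h₂
  rw [h, linearization, secondDeriv_eq hf]
  simp only [twoSubA, sub_eq_add_neg x 1, h₀, h₁, h₂]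

theorem conjOp_zero_mulL_coshPow_neg (hσ : MemLp σ ∞ (volume : Measure ℝ)) (hq : 0 ≤ q) {U : L2}
    (hU : U ∈ sobolev 2) :
    conjOp c σ 0 (mulL (coshPow (-q)) U) = mulL (coshPow (-q)) (conjOp c σ q U) :=
  Lp.ext <| (conjOp_zero_ae hσ (mulL_mem_sobolev_two (bddSmooth_coshPow_neg hq) hU)).trans
    (mulL_coshPow_neg_conjOp hσ hq hU).symm

theorem IsInvertible.isEvenIso (h : IsInvertible c ς 2 0 q)
    (hσ : MemLp σ ∞ (volume : Measure ℝ)) (hς : σ =ᵐ[volume] fun x => 1 + 2 * ς x) (hq : 0 < q) :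
    IsEvenIso c σ q := by
  obtain ⟨T, hT, -, C, hC⟩ := h
  have coe_T {U : L2} (hU : U ∈ sobolev 2) (hUE : mulL (coshPow (-q)) U ∈ E 2 q) :
      (T ⟨_, hUE⟩ : L2) = mulL (coshPow (-q)) (conjOp c σ q U) := by
    rw [← conjOp_zero_mulL_coshPow_neg hσ hq.le hU]
    exact Lp.ext <| (hT _).trans (conjOp_zero_ae_linearization hσ hς hUE.1.1).symm
  refine ⟨⟨C, fun U hU => ?_⟩, fun G hG => ?_⟩
  · have hUE := (mem_E_iff hq.le).2
      ⟨mulL_mem_sobolev_two (bddSmooth_coshPow_neg hq.le) hU.1, U, hU, rfl⟩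
    have := hC (T ⟨_, hUE⟩)
    rwa [LinearEquiv.symm_apply_apply, coe_T hU.1, weightedENorm_mulL_coshPow_neg hq.le,
      weightedENorm_mulL_coshPow_neg hq.le, sobolevENorm_zero_left] at this
  · have hGE := (mem_E₀_iff (r := 0) hq.le).2
      ⟨mem_sobolev_zero _, G, ⟨mem_sobolev_zero _, hG⟩, rfl⟩
    obtain ⟨-, U, hU, hUT⟩ := (mem_E_iff hq.le).1 (T.symm ⟨_, hGE⟩).2
    refine ⟨U, hU, mulL_coshPow_neg_injective hq.le ?_⟩
    rw [← coe_T hU.1 (hUT ▸ (T.symm ⟨_, hGE⟩).2)]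
    simp only [hUT, Subtype.coe_eta, LinearEquiv.apply_symm_apply]

theorem conjOp_zero_mem_E₀ (hσ : BddSmooth σ) (hσ' : ∀ x, σ (-x) = σ x) (hq : 0 < q) (hr : 0 ≤ r)
    {f : L2} (hf : f ∈ E (r + 2) q) : conjOp c σ 0 f ∈ E₀ r q := by
  obtain ⟨hfr, U, hU, rfl⟩ := (mem_E_iff hq.le).1 hf
  have hU₂ := sobolev_anti (le_add_of_nonneg_left hr) hU.1
  obtain ⟨_, h₀⟩ := sobolevBdd_conjOp (c := c) (q := 0) hσ hr
  obtain ⟨_, h₁⟩ := sobolevBdd_conjOp (c := c) (q := q) hσ hr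
  exact (mem_E₀_iff hq.le).2 ⟨(h₀ _ hfr).1, conjOp c σ q U,
    ⟨(h₁ U hU.1).1, conjOp_mem_evenPerp hσ.memLp_top hσ' hq hU₂ hU.2⟩,
    (conjOp_zero_mulL_coshPow_neg hσ.memLp_top hq.le hU₂).symm⟩

/-- The operator `c² ∂² + (2 - A) σ` between the weighted Sobolev spaces. -/
def weightedMap (c : ℝ) (hσ : BddSmooth σ) (hσ' : ∀ x, σ (-x) = σ x) (hq : 0 < q) (hr : 0 ≤ r) :
    E (r + 2) q →ₗ[ℂ] E₀ r q where
  toFun f := ⟨conjOp c σ 0 f, conjOp_zero_mem_E₀ hσ hσ' hq hr f.2⟩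
  map_add' f g := Subtype.ext <| conjOp_add (sobolev_anti (le_add_of_nonneg_left hr) f.2.1.1)
    (sobolev_anti (le_add_of_nonneg_left hr) g.2.1.1)
  map_smul' a f := Subtype.ext <| conjOp_smul a (sobolev_anti (le_add_of_nonneg_left hr) f.2.1.1)

theorem exists_weightedENorm_weightedMap_le (hσ : BddSmooth σ) (hσ' : ∀ x, σ (-x) = σ x)
    (hq : 0 < q) (hr : 0 ≤ r) : ∃ C : ℝ≥0, ∀ f, weightedENorm r q (weightedMap c hσ hσ' hq hr f) ≤
      C * weightedENorm (r + 2) q f := by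
  obtain ⟨C, hC⟩ := sobolevBdd_conjOp (c := c) (q := q) hσ hr
  refine ⟨C, fun f => ?_⟩
  obtain ⟨-, U, hU, hUf⟩ := (mem_E_iff hq.le).1 f.2
  change weightedENorm r q (conjOp c σ 0 f) ≤ _
  rw [← hUf, conjOp_zero_mulL_coshPow_neg hσ.memLp_top hq.le
    (sobolev_anti (le_add_of_nonneg_left hr) hU.1), weightedENorm_mulL_coshPow_neg hq.le,
    weightedENorm_mulL_coshPow_neg hq.le]
  exact (hC U hU.1).2

theorem IsEvenIso.injective_weightedMap (h : IsEvenIso c σ q) (hσ : BddSmooth σ)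
    (hσ' : ∀ x, σ (-x) = σ x) (hq : 0 < q) (hr : 0 ≤ r) :
    Function.Injective (weightedMap c hσ hσ' hq hr) := by
  rw [injective_iff_map_eq_zero]
  intro f hf
  obtain ⟨-, U, hU, hUf⟩ := (mem_E_iff hq.le).1 f.2
  have hU₂ := sobolev_anti (le_add_of_nonneg_left hr) hU.1
  have conj_eq : conjOp c σ q U = 0 := by
    refine mulL_coshPow_neg_injective hq.le ?_
    rw [← conjOp_zero_mulL_coshPow_neg hσ.memLp_top hq.le hU₂, hUf, map_zero]
    exact congrArg Subtype.val hf
  obtain ⟨C, hC⟩ := h.exists_le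
  have norm_eq : ‖U‖ₑ = 0 := by
    simpa [conj_eq] using (enorm_le_sobolevENorm zero_le_two U).trans (hC U ⟨hU₂, hU.2⟩)
  refine Subtype.ext ?_
  rw [← hUf, enorm_eq_zero.1 norm_eq, map_zero]
  rfl

theorem IsEvenIso.exists_weightedMap_eq (h : IsEvenIso c σ q) (hc : c ≠ 0) (hσ : BddSmooth σ)
    (hσ' : ∀ x, σ (-x) = σ x) (hq : 0 < q) (hr : 0 ≤ r) : ∃ C : ℝ≥0, ∀ g, ∃ f,
      weightedMap c hσ hσ' hq hr f = g ∧ weightedENorm (r + 2) q f ≤ C * weightedENorm r q g := by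
  obtain ⟨C, hC⟩ := h.exists_le
  obtain ⟨K, hK⟩ := ellipticEstimate hc hσ q hr
  obtain ⟨_, regular⟩ := ellipticEstimate hc hσ 0 hr
  refine ⟨K * (C + 1), fun g => ?_⟩
  obtain ⟨hg, G, hG, hGg⟩ := (mem_E₀_iff hq.le).1 g.2
  obtain ⟨U, hU, rfl⟩ := h.exists_eq G hG.2
  obtain ⟨hUr, U_le⟩ := hK U hU.1 hG.1
  have hfg : conjOp c σ 0 (mulL (coshPow (-q)) U) = g := by
    rw [conjOp_zero_mulL_coshPow_neg hσ.memLp_top hq.le hU.1, hGg]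
  have hf := (regular _ (mulL_mem_sobolev_two (bddSmooth_coshPow_neg hq.le) hU.1) (hfg ▸ hg)).1
  refine ⟨⟨_, (mem_E_iff hq.le).2 ⟨hf, U, ⟨hUr, hU.2⟩, rfl⟩⟩, Subtype.ext hfg, ?_⟩
  rw [← hGg, weightedENorm_mulL_coshPow_neg hq.le, weightedENorm_mulL_coshPow_neg hq.le]
  calc sobolevENorm (r + 2) U
      ≤ K * (C * ‖conjOp c σ q U‖ₑ + sobolevENorm r (conjOp c σ q U)) :=
        U_le.trans (by gcongr; exact hC U hU)
    _ ≤ K * (C * sobolevENorm r (conjOp c σ q U) + sobolevENorm r (conjOp c σ q U)) := by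
        gcongr
        exact enorm_le_sobolevENorm hr _
    _ = (K * (C + 1) : ℝ≥0) * sobolevENorm r (conjOp c σ q U) := by push_cast; ring

theorem IsEvenIso.isInvertible (h : IsEvenIso c σ q) (hc : c ≠ 0) (hσ : BddSmooth σ)
    (hσ' : ∀ x, σ (-x) = σ x) (hς : σ =ᵐ[volume] fun x => 1 + 2 * ς x) (hq : 0 < q)
    (hr : 0 ≤ r) : IsInvertible c ς (r + 2) r q := by
  obtain ⟨C, preimage⟩ := h.exists_weightedMap_eq hc hσ hσ' hq hr
  let T := LinearEquiv.ofBijective (weightedMap c hσ hσ' hq hr)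
    ⟨h.injective_weightedMap hσ hσ' hq hr, fun g => (preimage g).imp fun f hf => hf.1⟩
  refine ⟨T, fun f => ?_, exists_weightedENorm_weightedMap_le hσ hσ' hq hr, C, fun g => ?_⟩
  · exact conjOp_zero_ae_linearization hσ.memLp_top hς
      (sobolev_anti (le_add_of_nonneg_left hr) f.2.1.1)
  · obtain ⟨f, rfl, f_le⟩ := preimage g
    exact (T.symm_apply_apply f).symm ▸ f_le

end

end MonatomicFPUT

end

open MonatomicFPUT in
theorem proposition5p1_general {c : ℝ} (hc : c ≠ 0) {ς : L2} (hς : ς ∈ sobolev 2)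
    (hς_even : ς ∈ evenL2) (hς_wave : IsTravelingWave c ς) {q₁ : ℝ} (hq₁ : 0 < q₁)
    (h : IsInvertible c ς 2 0 q₁) :
    ∃ q₂ > q₁, ∀ q ∈ Set.Icc q₁ q₂, ∀ r : ℝ, 0 ≤ r → IsInvertible c ς (r + 2) r q := by
  have hς₁ := sobolev_anti one_le_two hς
  let σ : ℝ → ℂ := fun x => 1 + 2 * contRep ς x
  have hσ : BddSmooth σ :=
    (BddContDiff.const 1).add ((hς_wave.bddSmooth_contRep hc hς).const_mul 2)
  have hσ' (x : ℝ) : σ (-x) = σ x := by simp only [σ, contRep_neg hς₁ hς_even]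
  have hσς : σ =ᵐ[volume] fun x => 1 + 2 * ς x :=
    (contRep_ae hς₁).mono fun x hx => by simp only [σ, hx]
  obtain ⟨ε, hε, hball⟩ := Metric.eventually_nhds_iff_ball.1
    ((h.isEvenIso hσ.memLp_top hσς hq₁).eventually hσ hσ' hq₁)
  refine ⟨q₁ + ε / 2, by linarith, fun q hq r hr => ?_⟩
  have hqε : q ∈ Metric.ball q₁ ε := by
    rw [Real.ball_eq_Ioo]
    exact ⟨by linarith [hq.1], by linarith [hq.2]⟩
  exact (hball q hqε).isInvertible hc hσ hσ' hσς (hq₁.trans_le hq.1) hr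

theorem proposition5p1 (c : ℝ) (hc : 1 < |c|)
    (qς : ℝ) (hqς : 0 < qς)
    (ς : MonatomicFPUT.L2)
    (hς_mem : ς ∈ MonatomicFPUT.E 2 qς)
    (hς_real : ∀ᵐ x : ℝ, (ς x).im = 0)
    (hς_wave : MonatomicFPUT.IsTravelingWave c ς)
    (qH : ℝ) (hqH : 0 < qH) (hqH' : qH < min 1 qς)
    (hH : MonatomicFPUT.IsInvertible c ς 2 0 qH) :
    ∃ q₁ q₂ : ℝ, qH ≤ q₁ ∧ q₁ < q₂ ∧ q₂ < min 1 qς ∧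
      ∀ q ∈ Set.Icc q₁ q₂, ∀ r : ℝ, 0 ≤ r →
        MonatomicFPUT.IsInvertible c ς (r + 2) r q := by
  have hc₀ : c ≠ 0 := abs_pos.1 (one_pos.trans hc)
  obtain ⟨q₂, hq₂, hinv⟩ :=
    proposition5p1_general hc₀ hς_mem.1.1 hς_mem.2 hς_wave hqH hH
  obtain ⟨q₃, hq₃, hq₃'⟩ := exists_between (lt_min hq₂ hqH')
  exact ⟨qH, q₃, le_rfl, hq₃, hq₃'.trans_le (min_le_right _ _), fun q hq r hr =>
    hinv q ⟨hq.1, hq.2.trans (hq₃'.le.trans (min_le_left _ _))⟩ r hr⟩
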